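/- Let $(\mathbf X,\mathbf Z)\sim P_{\mathbf X,\mathbf Z}$ be a pair of random variables. The coding distribution shared by sender and receiver is the marginal $P=P_{\mathbf Z}$; let $Q=Q_{\mathbf Z\mid\mathbf X}$ be the conditional law of $\mathbf Z$ given $\mathbf X$. Let $P$ and $Q$ have densities $p(z)$ and $q(z)=q(x,z)$ (jointly measurable in the data value $x$ and $z$) with respect to a common $\sigma$-finite reference measure. Let $B_1,\dots,B_J$ be a partition of $P$'s support into bins with $P(B_j)=1/J$; more generally the bins may overlap, i.e. be given by nonnegative bin densities that sum to $p$ and each integrate to $1/J$ (then "$z\in B_j$" means that the $j$-th bin density is nonzero at $z$, and $P|_{B_j}$ is the normalised $j$-th bin density). For each value of $\mathbf X$ let $\pi$ be a probability distribution on $\{1,\dots,J\}$, depending measurably on the value of $\mathbf X$, with $\pi(j)>0$ whenever $Q(B_j)>0$, and otherwise arbitrary. Given $\mathbf X$, the encoder (PFR with space partitioning) starts from $t_0=0$, $\tau^*=\infty$ and counters $\tilde n_j=0$, and puts $$r'_{\max}=\max_{j}\sup_{z\in B_j}\frac{q(z)}{p(z)}\,\frac{P(B_j)}{\pi(j)}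 .$$ In iteration $n=1,2,\dots$ it draws $\Delta t_n\sim\mathrm{Exp}(1)$ and sets $t_n=t_{n-1}+\Delta t_n$; draws $j_n\sim\pi$ and increases $\tilde n_{j_n}$ by one; lets $z_n$ be the $\tilde n_{j_n}$-th element of an i.i.d. sequence of samples from $P|_{B_{j_n}}$ belonging to bin $j_n$; and computes $\tau_n=J\,\pi(j_n)\,t_n\,p(z_n)/q(z_n)$. If $\tau_n\le\tau^*$ it sets $\tau^*=\tau_n$, $j^*=j_n$, $\tilde n^*=\tilde n_{j_n}$. It then halts if $t_n/r'_{\max}>\tau^*$. Given $\mathbf X$, the waiting times, the bin indices and the sample sequences of the different bins are all independent. The code $(j^*,\tilde n^*)$ is the value held when the encoder halts or, if it does not halt, the value at which $(j^*,\tilde n^*)$ stabilises. Then $(j^*,\tilde n^*)$ is well defined almost surely, and the entropy in bits of this two-part code (over the randomness of both $\mathbf X$ and the encoder) satisfies $$\mathbb H[j^*,\tilde n^*]\le I[\mathbf X;\mathbf Z]+\mathbb E_{\mathbf X}[\epsilon]+\log_2\bigl(I[\mathbf X;\mathbf Z]-\log_2 J+\mathbb E_{\mathbf X}[\epsilon]+1\bigr)+4,$$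 where $$\epsilon=\mathbb E_{z\sim Q_{\mathbf Z\mid\mathbf X}}\Bigl[\max\Bigl\{0,\ \log_2 J-\log_2\frac{q(z)}{p(z)}\Bigr\}\Bigr],$$ the mutual information $I$ is measured in bits, and the right-hand side is $\infty$ if $I[\mathbf X;\mathbf Z]=\infty$. The bound holds for every choice of the bins and of $\pi$, and its right-hand side depends on neither (only on $J$). -/

import Mathlib

open MeasureTheory ProbabilityTheory Filter
open scoped ENNReal

noncomputable section

namespace SpacePartitionPFR

/-! ### Bins -/

/-- `J` bins of equal mass for the coding distribution with density `p` with respect to `ν`.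
Bin `j` is given by its unnormalised density `density j` (for an ordinary partition into sets
`S j` this is `p` restricted to `S j`, see `BinSystem.ofPartition`). The bins may overlap: the only
requirements are that their densities sum to `p` and that every bin has mass `1 / J`. -/
structure BinSystem {𝓩 : Type*} [MeasurableSpace 𝓩] (ν : Measure 𝓩) (p : 𝓩 → ℝ≥0∞) (J : ℕ) where
  density : Fin J → 𝓩 → ℝ≥0∞
  measurable_density : ∀ j, Measurable (density j)
  sum_density : ∀ᵐ z ∂ν, ∑ j, density j z = p z
  mass : ∀ j, ∫⁻ z, density j z ∂ν = (J : ℝ≥0∞)⁻¹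

namespace BinSystem

variable {𝓩 : Type*} [MeasurableSpace 𝓩] {ν : Measure 𝓩} {p : 𝓩 → ℝ≥0∞} {J : ℕ}

/-- The region occupied by bin `j`. -/
def region (B : BinSystem ν p J) (j : Fin J) : Set 𝓩 := {z | B.density j z ≠ 0}

/-- The coding distribution restricted to bin `j` and normalised, `P|_{B_j}`. -/
def law (B : BinSystem ν p J) (j : Fin J) : Measure 𝓩 :=
  (J : ℝ≥0∞) • ν.withDensity (B.density j)

instance (B : BinSystem ν p J) (j : Fin J) : IsProbabilityMeasure (B.law j) := by
  constructor
  have hJ : (J : ℝ≥0∞) ≠ 0 := by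
    have := j.pos
    exact_mod_cast this.ne'
  simp [law, B.mass j, ENNReal.mul_inv_cancel hJ (ENNReal.natCast_ne_top J)]

/-- A partition of the space (up to `P`-null sets) into sets of `P`-mass `1 / J`, as bins. -/
def ofPartition (hp : Measurable p) (S : Fin J → Set 𝓩) (hS : ∀ j, MeasurableSet (S j))
    (hdisj : Pairwise (Function.onFun Disjoint S))
    (hcover : ∀ᵐ z ∂(ν.withDensity p), z ∈ ⋃ j, S j)
    (hmass : ∀ j, ν.withDensity p (S j) = (J : ℝ≥0∞)⁻¹) : BinSystem ν p J where
  density j := (S j).indicator p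
  measurable_density j := hp.indicator (hS j)
  sum_density := by
    rw [ae_withDensity_iff hp] at hcover
    filter_upwards [hcover] with z hz
    by_cases hpz : p z = 0
    · rw [hpz]
      refine Finset.sum_eq_zero fun j _ => ?_
      by_cases h : z ∈ S j <;> simp [h, hpz]
    · obtain ⟨j, hj⟩ := Set.mem_iUnion.1 (hz hpz)
      rw [Finset.sum_eq_single j]
      · simp [hj]
      · intro i _ hij
        exact Set.indicator_of_notMem (fun hi => Set.disjoint_left.1 (hdisj hij) hi hj) _
      · simp
  mass j := by
    rw [← hmass j, withDensity_apply _ (hS j), lintegral_indicator (hS j)]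

/-- For an ordinary partition, `law j` is the coding distribution conditioned on the `j`-th set. -/
lemma ofPartition_law (hp : Measurable p) (S : Fin J → Set 𝓩) (hS : ∀ j, MeasurableSet (S j))
    (hdisj : Pairwise (Function.onFun Disjoint S))
    (hcover : ∀ᵐ z ∂(ν.withDensity p), z ∈ ⋃ j, S j)
    (hmass : ∀ j, ν.withDensity p (S j) = (J : ℝ≥0∞)⁻¹) (j : Fin J) :
    (ofPartition hp S hS hdisj hcover hmass).law j = (ν.withDensity p)[|S j] := by
  rw [law, ProbabilityTheory.cond, hmass j, inv_inv, restrict_withDensity (hS j),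
    ← withDensity_indicator (hS j)]
  rfl

end BinSystem

/-! ### The encoder -/

/-- State of the encoder: the time `t_n`, the number `ñ_j` of samples drawn so far in each bin, the
best score `τ*`, the code `(j*, ñ*)` of the best sample (`none` before the first sample), and
whether the stopping criterion has been met. -/
structure State (J : ℕ) where
  time : ℝ
  count : Fin J → ℕ
  bestScore : ℝ≥0∞
  code : Option (Fin J × ℕ)
  halted : Prop

/-- The initial state. -/
def State.init (J : ℕ) : State J where
  time := 0
  count := fun _ => 0
  bestScore := ∞
  code := none
  halted := False

open scoped Classical in
/-- One iteration: `Δ` is the exponential waiting time, `j` the sampled bin, `sample j k` the `k`-th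
sample of bin `j`, `w` the categorical distribution on the bins and `rmax` the bound used in
the stopping criterion. Nothing changes once the encoder has halted. -/
def step {𝓩 : Type*} {J : ℕ} (p q : 𝓩 → ℝ≥0∞) (w : Fin J → ℝ≥0∞) (rmax : ℝ≥0∞)
    (sample : Fin J × ℕ → 𝓩) (Δ : ℝ) (j : Fin J) (s : State J) : State J :=
  if s.halted then s else
    let t := s.time + Δ
    let k := s.count j + 1
    let z := sample (j, k)
    let τ := J * w j * ENNReal.ofReal t * p z / q z
    let best := if τ ≤ s.bestScore then τ else s.bestScore
    { time := t
      count := Function.update s.count j k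
      bestScore := best
      code := if τ ≤ s.bestScore then some (j, k) else s.code
      halted := best < ENNReal.ofReal t / rmax }

/-- `r'_max = max_j sup_{z ∈ B_j} (q(z) / p(z)) (P(B_j) / π(j))`, where `P(B_j) = 1 / J`. -/
def ratioBound {𝓩 : Type*} [MeasurableSpace 𝓩] {ν : Measure 𝓩} {p : 𝓩 → ℝ≥0∞} {J : ℕ}
    (B : BinSystem ν p J) (q : 𝓩 → ℝ≥0∞) (w : Fin J → ℝ≥0∞) : ℝ≥0∞ :=
  ⨆ j, ⨆ z ∈ B.region j, q z / p z * ((J : ℝ≥0∞)⁻¹ / w j)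

/-- The randomness of one run: the waiting times `Δt_n`, the bin indices `j_n`, and for every bin
its own sequence of samples. -/
abbrev Randomness (𝓩 : Type*) (J : ℕ) : Type _ :=
  (ℕ → ℝ) × (ℕ → Fin J) × (Fin J × ℕ → 𝓩)

/-- The state of the encoder with target density `q` after `n` iterations. -/
def run {𝓩 : Type*} [MeasurableSpace 𝓩] {ν : Measure 𝓩} {p : 𝓩 → ℝ≥0∞} {J : ℕ}
    (B : BinSystem ν p J) (q : 𝓩 → ℝ≥0∞) (w : Fin J → ℝ≥0∞) (ω : Randomness 𝓩 J) :
    ℕ → State J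
  | 0 => State.init J
  | n + 1 => step p q w (ratioBound B q w) ω.2.2 (ω.1 n) (ω.2.1 n) (run B q w ω n)

open scoped Classical in
/-- The code produced by a run: the eventual value of `(j*, ñ*)`. Since the state is frozen once the
stopping criterion is met, this is the returned value whenever the run halts; if the run does not
halt (which can only happen when `r'_max = ∞`, up to null events), it is the code of the global
minimiser `argmin_{n ∈ ℕ} τ_n`. It is `none` if `(j*, ñ*)` does not stabilise. -/
def output {J : ℕ} (s : ℕ → State J) : Option (Fin J × ℕ) :=
  if h : ∃ c, ∀ᶠ n in atTop, (s n).code = c then h.choose else none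

/-- If the encoder has halted after `n` iterations, its output is the code held at that point. -/
lemma output_run_of_halted {𝓩 : Type*} [MeasurableSpace 𝓩] {ν : Measure 𝓩} {p : 𝓩 → ℝ≥0∞} {J : ℕ}
    (B : BinSystem ν p J) (q : 𝓩 → ℝ≥0∞) (w : Fin J → ℝ≥0∞) (ω : Randomness 𝓩 J) (n : ℕ)
    (hn : (run B q w ω n).halted) : output (run B q w ω) = (run B q w ω n).code := by
  have hfix : ∀ m, n ≤ m → run B q w ω m = run B q w ω n := by
    intro m hm
    induction m, hm using Nat.le_induction with
    | base => rfl
    | succ m _ ih => rw [run, ih, step, if_pos hn]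
  have hev : ∀ᶠ m in atTop, (run B q w ω m).code = (run B q w ω n).code :=
    eventually_atTop.2 ⟨n, fun m hm => by rw [hfix m hm]⟩
  have h : ∃ c, ∀ᶠ m in atTop, (run B q w ω m).code = c := ⟨_, hev⟩
  rw [output, dif_pos h]
  obtain ⟨m, h1, h2⟩ := (h.choose_spec.and hev).exists
  rw [← h1, h2]

/-! ### The law of the randomness -/

instance : IsProbabilityMeasure (expMeasure 1) := isProbabilityMeasure_expMeasure one_pos

/-- Given `x`, an i.i.d. sequence with common law `κ x`. -/
def iidKernel {𝓧 α : Type*} [MeasurableSpace 𝓧] [MeasurableSpace α] (κ : Kernel 𝓧 α)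
    [IsMarkovKernel κ] : Kernel 𝓧 (ℕ → α) where
  toFun x := Measure.infinitePi (fun _ : ℕ => κ x)
  measurable' := by
    refine Measurable.measure_of_isPiSystem_of_isProbabilityMeasure
      (generateFrom_squareCylinders (α := fun _ : ℕ => α)).symm
      (isPiSystem_squareCylinders (fun _ => MeasurableSpace.isPiSystem_measurableSet)
        (fun _ => MeasurableSet.univ)) ?_
    rintro _ ⟨s, t, ht, rfl⟩
    have ht' : ∀ i, MeasurableSet (t i) := fun i => by simpa using ht i (Set.mem_univ i)
    simp_rw [Measure.infinitePi_pi _ (fun i _ => ht' i)]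
    exact Finset.measurable_prod _ fun i _ => κ.measurable_coe (ht' i)

instance {𝓧 α : Type*} [MeasurableSpace 𝓧] [MeasurableSpace α] (κ : Kernel 𝓧 α)
    [IsMarkovKernel κ] : IsMarkovKernel (iidKernel κ) :=
  ⟨fun x => inferInstanceAs (IsProbabilityMeasure (Measure.infinitePi (fun _ : ℕ => κ x)))⟩

/-- The law of the randomness given the data `x`: independently, i.i.d. `Exp(1)` waiting times,
i.i.d. bin indices with law `π x`, and independent samples, those of bin `j` having law
`P|_{B_j}`. -/
def randomnessKernel {𝓧 𝓩 : Type*} [MeasurableSpace 𝓧] [MeasurableSpace 𝓩] {ν : Measure 𝓩}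
    {p : 𝓩 → ℝ≥0∞} {J : ℕ} (B : BinSystem ν p J) (π : Kernel 𝓧 (Fin J)) [IsMarkovKernel π] :
    Kernel 𝓧 (Randomness 𝓩 J) :=
  Kernel.const 𝓧 (Measure.infinitePi (fun _ : ℕ => expMeasure 1)) ×ₖ
    (iidKernel π ×ₖ
      Kernel.const 𝓧 (Measure.infinitePi (fun jk : Fin J × ℕ => B.law jk.1)))

instance {𝓧 𝓩 : Type*} [MeasurableSpace 𝓧] [MeasurableSpace 𝓩] {ν : Measure 𝓩}
    {p : 𝓩 → ℝ≥0∞} {J : ℕ} (B : BinSystem ν p J) (π : Kernel 𝓧 (Fin J)) [IsMarkovKernel π] :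
    IsMarkovKernel (randomnessKernel B π) := by
  unfold randomnessKernel
  infer_instance

/-! ### Information quantities, in bits -/

/-- Shannon entropy in bits of a discrete random variable `C` under `μ`. -/
def entropyBits {Ω α : Type*} [MeasurableSpace Ω] (μ : Measure Ω) (C : Ω → α) : ℝ≥0∞ :=
  ∑' c, ENNReal.ofReal (Real.negMulLog (μ.real {ω | C ω = c}) / Real.log 2)

/-- Mutual information in bits of a pair with joint law `ρ`. -/
def mutualInfoBits {𝓧 𝓩 : Type*} [MeasurableSpace 𝓧] [MeasurableSpace 𝓩]
    (ρ : Measure (𝓧 × 𝓩)) : ℝ≥0∞ :=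
  InformationTheory.klDiv ρ (ρ.fst.prod ρ.snd) / ENNReal.ofReal (Real.log 2)

/-- `ε = E_{z ∼ Q} [max {0, log₂ J - log₂ (q(z) / p(z))}]` for a target `Q` with density `q`. -/
def epsilonCost {𝓩 : Type*} [MeasurableSpace 𝓩] (J : ℕ) (Q : Measure 𝓩) (p q : 𝓩 → ℝ≥0∞) : ℝ≥0∞ :=
  ∫⁻ z, ENNReal.ofReal (max 0 (Real.logb 2 J - Real.logb 2 (q z / p z).toReal)) ∂Q

/-- Base-two logarithm on the extended reals, with `log₂ ∞ = ∞`. -/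
def elog2 (x : EReal) : EReal := ENNReal.log x.toENNReal / (Real.log 2 : ℝ)

end SpacePartitionPFR

end

/-! Fix the data value `x`, write `r = q / p`, and let the mark of the `n`-th iteration be the
pair `(j_n, z_n)`. Since distinct iterations read distinct entries of the sample sequences, the
marks are i.i.d. (`map_markedPoints`), and together with the arrival times `t_n` they form a
marked Poisson process. The encoder minimises the score `τ_n = t_n / g(j_n, z_n)` with `g(j, z) =
r(z) / (J π(j))`, a density of mean one under the law of the marks, whose weighted marginal in `z`
is `Q` (`lintegral_mul_gain`). A point arriving at time `t` has score at least `t / r'_max`, so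
the stopping rule never discards the minimiser, and the output is its index whether or not the
encoder halts (`output_run_eq`).

The probabilistic input is the Mecke formula (`mecke`): summing over the points of the process a
function of the point and of the remaining configuration is the same as adding an independent
point. It is proved by merging the two gaps around the removed point. Let `S(s)` be the
probability that all scores exceed `s`. Applied to the minimiser, the formula says that its score
has density `S` on the half-line and that its mark is independent of its score, with law `g` times
the law of the marks. In particular `∫ S ≤ 1`, and hence also `∫ s S(s) ds = ∫_a ∫_{s > a} S ≤ ∫ S
≤ 1`; the exponential form of `S` is never needed. Applied once more to an earlier point of the
same bin, it bounds the expected number of such points, given the mark `(j, z)` and the score `s`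
of the minimiser, by its arrival time `s g(j, z)` times `π(j)`, that is, by `s r(z) / J`
(`tsum_lintegral_earlierInBin_le`). Finiteness of the number of scores below any level, and the
absence of ties, follow from the same formula (`ae_exists_isArgmin`).

The tangent bound `log n ≤ log a + n / a - 1` at `a = 1 + r(z) / J` then gives `E[log ñ* | x] ≤
E_Q[log (1 + r / J)]` (`tsum_lintegral_log_earlierInBin_le`). Because `log₂ (1 + u) ≤ 1 + max {0,
log₂ u}` and `max {0, log₂ (r / J)} = log₂ r - log₂ J + max {0, log₂ J - log₂ r}`, the mean of
`log₂ ñ*` is at most `A = I - log₂ J + E[ε] + 1` bits (`lintegral_log_ratio_le`), and `A ≥ 1`.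
Gibbs' inequality with code probabilities proportional to `n ^ (-(1 + 1 / A))`, uniform in `j`,
whose normalisation is at most `J (1 + A)`, bounds the entropy by `log₂ J + A + log₂ (1 + A) + 1`
(`entropyBits_le`), and `log₂ (1 + A) ≤ 1 + log₂ A` concludes. -/

noncomputable section

namespace SpacePartitionPFR

/-! ### Independent sequences -/

section IID
variable {A B : Type*}

/-- Prepending an element to a sequence. -/
def consSeq (p : A × (ℕ → A)) : ℕ → A
  | 0 => p.1
  | n + 1 => p.2 n

@[simp] lemma consSeq_zero (p : A × (ℕ → A)) : consSeq p 0 = p.1 := rfl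
@[simp] lemma consSeq_succ (p : A × (ℕ → A)) (n : ℕ) : consSeq p (n + 1) = p.2 n := rfl

variable [MeasurableSpace A] [MeasurableSpace B]

lemma lintegral_infinitePi_prod (α : Measure A) [IsProbabilityMeasure α] (s : Finset ℕ)
    (f : ℕ → A → ℝ≥0∞) (hf : ∀ i, Measurable (f i)) :
    ∫⁻ a, ∏ i ∈ s, f i (a i) ∂(Measure.infinitePi fun _ : ℕ => α) = ∏ i ∈ s, ∫⁻ a, f i a ∂α := by
  have h := lintegral_prod_eq_prod_lintegral_of_indepFun (μ := Measure.infinitePi fun _ : ℕ => α) s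
    (fun i a => f i (a i))
    (iIndepFun_infinitePi (P := fun _ => α) (X := fun i a => f i a) (fun i => hf i))
    (fun i => (hf i).comp (measurable_pi_apply i))
  rw [h]
  refine Finset.prod_congr rfl fun i _ => ?_
  rw [← (measurePreserving_eval_infinitePi (fun _ : ℕ => α) i).lintegral_comp (hf i)]

/-- If `a` is an i.i.d. sequence with law `α` and, given `a`, the `b i` are independent with laws
`κ (a i)`, then the pairs `(a i, b i)` are i.i.d. with law `α ⊗ₘ κ`. -/
lemma map_zip_eq_infinitePi {Ω : Type*} [MeasurableSpace Ω] (α : Measure A)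
    [IsProbabilityMeasure α] (κ : Kernel A B) [IsMarkovKernel κ] (P : Measure Ω)
    [IsProbabilityMeasure P] (b : (ℕ → A) → Ω → ℕ → B)
    (hb : Measurable (Function.uncurry b))
    (hlaw : ∀ a, P.map (b a) = Measure.infinitePi fun i => κ (a i)) :
    ((Measure.infinitePi fun _ : ℕ => α).prod P).map (fun p i => (p.1 i, b p.1 p.2 i)) =
      Measure.infinitePi fun _ : ℕ => α ⊗ₘ κ := by
  have hb' : ∀ i, Measurable fun p : (ℕ → A) × Ω => b p.1 p.2 i :=
    fun i => (measurable_pi_apply i).comp hb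
  have hm : Measurable fun (p : (ℕ → A) × Ω) i => (p.1 i, b p.1 p.2 i) :=
    measurable_pi_lambda _ fun i => ((measurable_pi_apply i).comp measurable_fst).prodMk (hb' i)
  refine Measure.eq_infinitePi _ fun s t ht => ?_
  have hset : MeasurableSet (Set.pi (s : Set ℕ) t) :=
    MeasurableSet.pi s.countable_toSet fun i _ => ht i
  rw [Measure.map_apply hm hset, Measure.prod_apply (hm hset)]
  have key : ∀ a : ℕ → A, P (Prod.mk a ⁻¹' ((fun (p : (ℕ → A) × Ω) i => (p.1 i, b p.1 p.2 i)) ⁻¹'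
      Set.pi (s : Set ℕ) t)) = ∏ i ∈ s, κ (a i) (Prod.mk (a i) ⁻¹' t i) := by
    intro a
    have hba : Measurable (b a) := hb.comp measurable_prodMk_left
    have hm' : ∀ i, MeasurableSet (Prod.mk (a i) ⁻¹' t i) := fun i => measurable_prodMk_left (ht i)
    rw [← Measure.infinitePi_pi (fun i => κ (a i)) (fun i _ => hm' i), ← hlaw a,
      Measure.map_apply hba (MeasurableSet.pi s.countable_toSet fun i _ => hm' i)]
    rfl
  simp_rw [key]
  rw [lintegral_infinitePi_prod α s (fun i a => κ a (Prod.mk a ⁻¹' t i))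
    fun i => Kernel.measurable_kernel_prodMk_left (ht i)]
  refine Finset.prod_congr rfl fun i _ => ?_
  rw [Measure.compProd_apply (ht i)]

/-- Distinct coordinates of an independent family are again independent. -/
lemma infinitePi_map_comp {ι : Type*} (μ : ι → Measure A) [∀ i, IsProbabilityMeasure (μ i)]
    (e : ℕ → ι) (he : Function.Injective e) :
    (Measure.infinitePi μ).map (fun ω n => ω (e n)) = Measure.infinitePi fun n => μ (e n) := by
  classical
  have hm : Measurable fun (ω : ι → A) n => ω (e n) :=
    measurable_pi_lambda _ fun n => measurable_pi_apply _
  refine Measure.eq_infinitePi _ fun s t ht => ?_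
  rw [Measure.map_apply hm (MeasurableSet.pi s.countable_toSet fun i _ => ht i)]
  have : (fun (ω : ι → A) n => ω (e n)) ⁻¹' Set.pi (s : Set ℕ) t =
      Set.pi (s.map ⟨e, he⟩ : Finset ι)
        fun i => if h : ∃ n, e n = i then t h.choose else Set.univ := by
    have hch : ∀ n, (⟨n, rfl⟩ : ∃ m, e m = e n).choose = n := fun n =>
      he (⟨n, rfl⟩ : ∃ m, e m = e n).choose_spec
    ext ω
    simp [Set.mem_pi, hch]
  rw [this, Measure.infinitePi_pi, Finset.prod_map]
  · refine Finset.prod_congr rfl fun n _ => ?_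
    have hch : (⟨n, rfl⟩ : ∃ m, e m = e n).choose = n :=
      he (⟨n, rfl⟩ : ∃ m, e m = e n).choose_spec
    simp [hch]
  · intro i _
    split_ifs with h
    · exact ht _
    · exact MeasurableSet.univ

@[fun_prop]
lemma measurable_consSeq : Measurable (consSeq (A := A)) := by
  refine measurable_pi_lambda _ fun n => ?_
  cases n with
  | zero => exact measurable_fst
  | succ n => exact (measurable_pi_apply n).comp measurable_snd

lemma map_consSeq (α : Measure A) [IsProbabilityMeasure α] :
    (α.prod (Measure.infinitePi fun _ : ℕ => α)).map consSeq =
      Measure.infinitePi fun _ : ℕ => α := by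
  classical
  refine Measure.eq_infinitePi _ fun s t ht => ?_
  rw [Measure.map_apply measurable_consSeq (MeasurableSet.pi s.countable_toSet fun i _ => ht i)]
  have hpre : consSeq ⁻¹' Set.pi (s : Set ℕ) t =
      (if 0 ∈ s then t 0 else Set.univ) ×ˢ
        Set.pi ((s.erase 0).image Nat.pred : Finset ℕ) (fun n => t (n + 1)) := by
    ext ⟨a, w⟩
    simp only [Set.mem_preimage, Set.mem_pi, Set.mem_prod, Finset.coe_image, Finset.mem_coe]
    constructor
    · intro h
      constructor
      · split_ifs with h0
        · exact h 0 h0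
        · trivial
      · rintro _ ⟨i, hi, rfl⟩
        obtain ⟨k, rfl⟩ := Nat.exists_eq_succ_of_ne_zero (Finset.ne_of_mem_erase hi)
        exact h (k + 1) (Finset.mem_of_mem_erase hi)
    · rintro ⟨h1, h2⟩ i hi
      cases i with
      | zero => simpa [hi] using h1
      | succ k => exact h2 k ⟨k + 1, by simp [hi], rfl⟩
  rw [hpre, Measure.prod_prod, Measure.infinitePi_pi _ (fun i _ => ht _), Finset.prod_image]
  · have h1 : ∏ i ∈ s.erase 0, α (t (Nat.pred i + 1)) = ∏ i ∈ s.erase 0, α (t i) :=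
      Finset.prod_congr rfl fun i hi => by
        rw [Nat.pred_eq_sub_one,
          Nat.sub_add_cancel (Nat.pos_of_ne_zero (Finset.ne_of_mem_erase hi))]
    rw [h1]
    split_ifs with h0
    · exact Finset.mul_prod_erase s (fun i => α (t i)) h0
    · rw [measure_univ, one_mul, Finset.erase_eq_of_notMem h0]
  · intro i hi j hj hij
    have hi' := Finset.ne_of_mem_erase hi
    have hj' := Finset.ne_of_mem_erase hj
    simp only [Nat.pred_eq_sub_one] at hij
    omega

lemma lintegral_infinitePi_cons (α : Measure A) [IsProbabilityMeasure α] (f : (ℕ → A) → ℝ≥0∞)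
    (hf : Measurable f) :
    ∫⁻ w, f w ∂(Measure.infinitePi fun _ : ℕ => α) =
      ∫⁻ a, ∫⁻ w, f (consSeq (a, w)) ∂(Measure.infinitePi fun _ : ℕ => α) ∂α := by
  conv_lhs => rw [← map_consSeq α]
  rw [lintegral_map hf measurable_consSeq, lintegral_prod _ (by fun_prop)]

end IID

/-! ### The Mecke formula for a marked Poisson process -/

section Mecke
variable {Y : Type*}

/-- The `n`-th arrival time of the renewal process whose gaps are the second components. -/
def arrival (w : ℕ → Y × ℝ) (n : ℕ) : ℝ := ∑ i ∈ Finset.range n, (w i).2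

/-- The configuration with its `n`-th point removed: the two gaps around it are merged. -/
def removePoint (n : ℕ) (w : ℕ → Y × ℝ) : ℕ → Y × ℝ := fun i =>
  if i < n then w i else if i = n then ((w (n + 1)).1, (w n).2 + (w (n + 1)).2) else w (i + 1)

lemma arrival_zero (w : ℕ → Y × ℝ) : arrival w 0 = 0 := rfl

lemma arrival_succ (w : ℕ → Y × ℝ) (n : ℕ) : arrival w (n + 1) = arrival w n + (w n).2 :=
  Finset.sum_range_succ _ _

lemma arrival_consSeq (p : Y × ℝ) (w : ℕ → Y × ℝ) (n : ℕ) :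
    arrival (consSeq (p, w)) (n + 1) = p.2 + arrival w n := by
  simp [arrival, Finset.sum_range_succ', add_comm]

lemma removePoint_zero_consSeq (p p' : Y × ℝ) (w : ℕ → Y × ℝ) :
    removePoint 0 (consSeq (p, consSeq (p', w))) = consSeq ((p'.1, p.2 + p'.2), w) := by
  funext i
  cases i <;> simp [removePoint]

lemma removePoint_succ_consSeq (n : ℕ) (p : Y × ℝ) (w : ℕ → Y × ℝ) :
    removePoint (n + 1) (consSeq (p, w)) = consSeq (p, removePoint n w) := by
  funext i
  cases i <;> simp [removePoint]

lemma arrival_removePoint (n : ℕ) (w : ℕ → Y × ℝ) (i : ℕ) :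
    arrival (removePoint n w) i = arrival w (if i ≤ n then i else i + 1) := by
  induction i with
  | zero => simp [arrival]
  | succ i ih =>
    rw [arrival_succ, ih]
    rcases lt_trichotomy i n with h | h | h
    · rw [if_pos h.le, if_pos (by omega : i + 1 ≤ n), arrival_succ]
      simp [removePoint, h]
    · subst h
      simp [removePoint, arrival_succ, add_assoc]
    · rw [if_neg (by omega), if_neg (by omega), arrival_succ w (i + 1)]
      simp [removePoint, h.not_gt, h.ne']

/-- The point of index `i` after removal of the point `n` is the point `i` or `i + 1`. -/
lemma point_removePoint (n : ℕ) (w : ℕ → Y × ℝ) (i : ℕ) :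
    (arrival (removePoint n w) (i + 1), (removePoint n w i).1) =
      (arrival w ((if i < n then i else i + 1) + 1), (w (if i < n then i else i + 1)).1) := by
  rw [arrival_removePoint]
  rcases lt_trichotomy i n with h | h | h
  · simp [removePoint, h]
  · subst h; simp [removePoint]
  · rw [if_neg (by omega : ¬ (i + 1 ≤ n)), if_neg h.not_gt]
    simp [removePoint, h.not_gt, h.ne']

lemma forall_point_removePoint (n : ℕ) (w : ℕ → Y × ℝ) (R : ℝ → Y → Prop) :
    (∀ i, R (arrival (removePoint n w) (i + 1)) (removePoint n w i).1) ↔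
      ∀ i, i ≠ n → R (arrival w (i + 1)) (w i).1 := by
  have h : ∀ i, R (arrival (removePoint n w) (i + 1)) (removePoint n w i).1 ↔
      R (arrival w ((if i < n then i else i + 1) + 1)) (w (if i < n then i else i + 1)).1 := by
    intro i
    have := point_removePoint n w i
    rw [Prod.mk.injEq] at this
    rw [this.1, this.2]
  simp_rw [h]
  constructor
  · intro H i hi
    rcases lt_or_gt_of_ne hi with h | h
    · simpa [h] using H i
    · obtain ⟨k, rfl⟩ := Nat.exists_eq_succ_of_ne_zero (by omega : i ≠ 0)
      simpa [show ¬ k < n by omega] using H k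
  · intro H i
    split_ifs with hi
    · exact H i hi.ne
    · exact H (i + 1) (by omega)

lemma sum_lt_le_tsum_removePoint (n : ℕ) (w : ℕ → Y × ℝ) (k : ℝ → Y → ℝ≥0∞) :
    ∑ i ∈ Finset.range n, k (arrival w (i + 1)) (w i).1 ≤
      ∑' i, k (arrival (removePoint n w) (i + 1)) (removePoint n w i).1 := by
  refine le_trans (le_of_eq ?_) (ENNReal.sum_le_tsum (Finset.range n))
  refine Finset.sum_congr rfl fun i hi => ?_
  have := point_removePoint n w i
  rw [Prod.mk.injEq] at this
  rw [this.1, this.2, if_pos (Finset.mem_range.1 hi)]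

lemma arrival_mono {w : ℕ → Y × ℝ} (hw : ∀ n, 0 < (w n).2) : StrictMono (arrival w) :=
  strictMono_nat_of_lt_succ fun n => by rw [arrival_succ]; linarith [hw n]

/-- The intervals between successive arrivals are disjoint. -/
lemma tsum_arrival_le (w : ℕ → Y × ℝ) (hw : ∀ n, 0 < (w n).2) (u : ℝ) (c : ℝ≥0∞) :
    ∑' n, (if arrival w n ≤ u ∧ u < arrival w (n + 1) then c else 0) ≤
      if 0 ≤ u then c else 0 := by
  by_cases h : ∃ n, arrival w n ≤ u ∧ u < arrival w (n + 1)
  · obtain ⟨n, hn⟩ := h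
    have hmono := arrival_mono hw
    rw [tsum_eq_single n, if_pos hn, if_pos]
    · exact (hmono.monotone (Nat.zero_le n)).trans hn.1
    · intro m hm
      rw [if_neg]
      rintro ⟨h1, h2⟩
      have h3 := hmono.lt_iff_lt.1 (hn.1.trans_lt h2)
      have h4 := hmono.lt_iff_lt.1 (h1.trans_lt hn.2)
      omega
  · push Not at h
    simp [fun n => if_neg (c := arrival w n ≤ u ∧ u < arrival w (n + 1)) (t := c) (e := 0)
      (fun h' => (h n h'.1).not_gt h'.2)]

lemma tsum_arrival_eq (w : ℕ → Y × ℝ) (hw : ∀ n, 0 < (w n).2)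
    (hw' : Tendsto (arrival w) atTop atTop) (u : ℝ) (c : ℝ≥0∞) :
    ∑' n, (if arrival w n ≤ u ∧ u < arrival w (n + 1) then c else 0) =
      if 0 ≤ u then c else 0 := by
  refine le_antisymm (tsum_arrival_le w hw u c) ?_
  split_ifs with h
  · classical
    have hex : ∃ n, u < arrival w n := (hw'.eventually_gt_atTop u).exists
    obtain ⟨k, hk⟩ := Nat.exists_eq_succ_of_ne_zero (n := Nat.find hex) (fun h0 => by
      have := Nat.find_spec hex
      rw [h0, arrival_zero] at this
      exact this.not_ge h)
    have h1 : u < arrival w (k + 1) := by have := Nat.find_spec hex; rwa [hk] at this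
    have h2 : arrival w k ≤ u := not_lt.1 (Nat.find_min hex (by omega))
    refine le_trans ?_ (ENNReal.le_tsum k)
    rw [if_pos ⟨h2, h1⟩]
  · exact zero_le

variable [MeasurableSpace Y]

@[fun_prop]
lemma measurable_arrival (n : ℕ) : Measurable fun w : ℕ → Y × ℝ => arrival w n := by
  unfold arrival; fun_prop

@[fun_prop]
lemma measurable_removePoint (n : ℕ) : Measurable (removePoint n : (ℕ → Y × ℝ) → _) := by
  refine measurable_pi_lambda _ fun i => ?_
  unfold removePoint
  split_ifs <;> fun_prop

lemma measurable_ite_le_lt {α : Type*} [MeasurableSpace α] {f g h : α → ℝ} {F : α → ℝ≥0∞}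
    (hf : Measurable f) (hg : Measurable g) (hh : Measurable h) (hF : Measurable F) :
    Measurable fun a => if f a ≤ g a ∧ g a < h a then F a else 0 :=
  Measurable.ite ((measurableSet_le hf hg).inter (measurableSet_lt hg hh)) hF measurable_const

lemma lintegral_expMeasure (f : ℝ → ℝ≥0∞) (hf : Measurable f) :
    ∫⁻ a, f a ∂(expMeasure 1) = ∫⁻ a, exponentialPDF 1 a * f a := by
  have h : expMeasure 1 = volume.withDensity (exponentialPDF 1) := rfl
  have hm : Measurable (exponentialPDF 1) := (measurable_exponentialPDFReal 1).ennreal_ofReal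
  rw [h, lintegral_withDensity_eq_lintegral_mul _ hm hf]
  rfl

lemma ae_pos_expMeasure : ∀ᵐ a ∂(expMeasure 1), 0 < a := by
  have h : expMeasure 1 = volume.withDensity (exponentialPDF 1) := rfl
  have hm : Measurable (exponentialPDF 1) := (measurable_exponentialPDFReal 1).ennreal_ofReal
  rw [h, ae_withDensity_iff hm]
  filter_upwards [Measure.ae_ne volume (0 : ℝ)] with a ha hpdf
  by_contra hneg
  exact hpdf (exponentialPDF_of_neg (lt_of_le_of_ne (not_lt.1 hneg) ha))

/-- If `a`, `b` are independent and exponential, then `(a, a + b)` has density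
`exp (-c)` on `0 ≤ a < c`: given the second arrival, the first is uniform. -/
lemma lintegral_exp_add_exp (f : ℝ × ℝ → ℝ≥0∞) (hf : Measurable f) :
    ∫⁻ a, ∫⁻ b, f (a, a + b) ∂(expMeasure 1) ∂(expMeasure 1) =
      ∫⁻ u, ∫⁻ c, (if 0 ≤ u ∧ u < c then f (u, c) else 0) ∂(expMeasure 1) := by
  have hm : Measurable (exponentialPDF 1) := (measurable_exponentialPDFReal 1).ennreal_ofReal
  have hset : MeasurableSet {p : ℝ × ℝ | 0 ≤ p.1 ∧ p.1 < p.2} := by measurability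
  have hg : Measurable fun p : ℝ × ℝ => if 0 ≤ p.1 ∧ p.1 < p.2 then f p else 0 :=
    Measurable.ite hset hf measurable_const
  rw [lintegral_expMeasure _ (Measurable.lintegral_prod_right'
    (f := fun p : ℝ × ℝ => f (p.1, p.1 + p.2)) (by fun_prop))]
  refine lintegral_congr fun a => ?_
  have hga : Measurable fun c => if 0 ≤ a ∧ a < c then f (a, c) else 0 :=
    hg.comp measurable_prodMk_left
  rw [lintegral_expMeasure _ (by fun_prop), lintegral_expMeasure _ hga,
    ← lintegral_const_mul _ (by fun_prop),
    ← lintegral_add_left_eq_self (fun c => exponentialPDF 1 c * _) a]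
  -- The second gap `b = 0` is excluded since there only one of the two sides vanishes.
  refine lintegral_congr_ae ?_
  filter_upwards [Measure.ae_ne volume (0 : ℝ)] with b hb
  rcases lt_or_ge a 0 with ha | ha
  · simp [exponentialPDF_of_neg ha, ha.not_ge]
  rcases lt_or_gt_of_ne hb with hb | hb
  · simp [exponentialPDF_of_neg hb, hb.not_gt]
  · rw [if_pos ⟨ha, by linarith⟩, ← mul_assoc]
    congr 1
    rw [exponentialPDF_of_nonneg ha, exponentialPDF_of_nonneg hb.le,
      exponentialPDF_of_nonneg (by linarith), ← ENNReal.ofReal_mul (by positivity)]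
    congr 1
    rw [one_mul, one_mul, one_mul, ← Real.exp_add]
    ring_nf

variable (M : Measure Y) [IsProbabilityMeasure M]

/-- The law of an i.i.d. sequence of marks with law `M` and `Exp(1)` gaps. -/
abbrev poissonLaw : Measure (ℕ → Y × ℝ) := Measure.infinitePi fun _ : ℕ => M.prod (expMeasure 1)

variable {M}

/-- The contribution of the `n`-th point to the Mecke formula: its position, given the configuration
without it, is distributed as Lebesgue measure between its arrivals `n` and `n + 1`. -/
lemma lintegral_removePoint (n : ℕ) (H : ℝ × Y × (ℕ → Y × ℝ) → ℝ≥0∞) (hH : Measurable H) :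
    ∫⁻ w, H (arrival w (n + 1), (w n).1, removePoint n w) ∂(poissonLaw M) =
      ∫⁻ u, ∫⁻ y, ∫⁻ w, (if arrival w n ≤ u ∧ u < arrival w (n + 1) then H (u, y, w) else 0)
        ∂(poissonLaw M) ∂M := by
  induction n generalizing H with
  | zero =>
    have hΦ : Measurable fun q : Y × ℝ × ℝ =>
        ∫⁻ y', ∫⁻ w, H (q.2.1, q.1, consSeq ((y', q.2.2), w)) ∂(poissonLaw M) ∂M :=
      Measurable.lintegral_prod_right' (f := fun r : (Y × ℝ × ℝ) × Y =>
        ∫⁻ w, H (r.1.2.1, r.1.1, consSeq ((r.2, r.1.2.2), w)) ∂(poissonLaw M))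
        (Measurable.lintegral_prod_right' (f := fun r : ((Y × ℝ × ℝ) × Y) × (ℕ → Y × ℝ) =>
          H (r.1.1.2.1, r.1.1.1, consSeq ((r.1.2, r.1.1.2.2), r.2))) (by fun_prop))
    have hLHS : ∀ p : Y × ℝ, ∫⁻ w, H (arrival (consSeq (p, w)) 1, (consSeq (p, w) 0).1,
        removePoint 0 (consSeq (p, w))) ∂(poissonLaw M) =
        ∫⁻ b, ∫⁻ y', ∫⁻ w, H (p.2, p.1, consSeq ((y', p.2 + b), w)) ∂(poissonLaw M) ∂M
          ∂(expMeasure 1) := by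
      intro p
      rw [lintegral_infinitePi_cons _ _ (by fun_prop)]
      simp_rw [removePoint_zero_consSeq, arrival_consSeq, arrival_zero, add_zero, consSeq_zero]
      rw [lintegral_prod_symm _ (Measurable.aemeasurable (Measurable.lintegral_prod_right'
        (f := fun r : (Y × ℝ) × (ℕ → Y × ℝ) =>
          H (p.2, p.1, consSeq ((r.1.1, p.2 + r.1.2), r.2))) (by fun_prop)))]
    have hRHS : ∀ u y, ∫⁻ w, (if arrival w 0 ≤ u ∧ u < arrival w (0 + 1) then H (u, y, w) else 0)
        ∂(poissonLaw M) = ∫⁻ c, (if 0 ≤ u ∧ u < c then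
          ∫⁻ y', ∫⁻ w, H (u, y, consSeq ((y', c), w)) ∂(poissonLaw M) ∂M else 0)
          ∂(expMeasure 1) := by
      intro u y
      have hm : Measurable fun w : ℕ → Y × ℝ =>
          if arrival w 0 ≤ u ∧ u < arrival w (0 + 1) then H (u, y, w) else 0 :=
        measurable_ite_le_lt (by fun_prop) (by fun_prop) (by fun_prop) (by fun_prop)
      rw [lintegral_infinitePi_cons _ _ hm, lintegral_prod_symm _ (Measurable.aemeasurable
        (Measurable.lintegral_prod_right' (f := fun r : (Y × ℝ) × (ℕ → Y × ℝ) =>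
          if arrival (consSeq r) 0 ≤ u ∧ u < arrival (consSeq r) (0 + 1) then
            H (u, y, consSeq r) else 0) (hm.comp measurable_consSeq)))]
      refine lintegral_congr fun c => ?_
      simp_rw [arrival_consSeq, arrival_zero, add_zero]
      split_ifs with h
      · rfl
      · simp
    have hite : Measurable fun r : (ℝ × Y) × ℝ => if 0 ≤ r.1.1 ∧ r.1.1 < r.2 then
        ∫⁻ y', ∫⁻ w, H (r.1.1, r.1.2, consSeq ((y', r.2), w)) ∂(poissonLaw M) ∂M else 0 :=
      measurable_ite_le_lt (by fun_prop) (by fun_prop) (by fun_prop)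
        (hΦ.comp (f := fun r : (ℝ × Y) × ℝ => (r.1.2, r.1.1, r.2)) (by fun_prop))
    rw [lintegral_infinitePi_cons _ _ (by fun_prop)]
    simp_rw [zero_add, hLHS]
    simp_rw [zero_add] at hRHS
    simp_rw [hRHS]
    rw [lintegral_prod _ (Measurable.aemeasurable (Measurable.lintegral_prod_right'
      (f := fun r : (Y × ℝ) × ℝ =>
      ∫⁻ y', ∫⁻ w, H (r.1.2, r.1.1, consSeq ((y', r.1.2 + r.2), w)) ∂(poissonLaw M) ∂M)
      (hΦ.comp (f := fun r : (Y × ℝ) × ℝ => (r.1.1, r.1.2, r.1.2 + r.2)) (by fun_prop))))]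
    refine Eq.trans ?_ (lintegral_lintegral_swap
      (Measurable.aemeasurable (Measurable.lintegral_prod_right' hite))).symm
    refine lintegral_congr fun y => ?_
    exact lintegral_exp_add_exp (fun p => ∫⁻ y', ∫⁻ w, H (p.1, y, consSeq ((y', p.2), w))
      ∂(poissonLaw M) ∂M) (hΦ.comp measurable_prodMk_left)
  | succ n ih =>
    have hite : ∀ n, Measurable fun r : (ℕ → Y × ℝ) × ℝ × Y =>
        if arrival r.1 n ≤ r.2.1 ∧ r.2.1 < arrival r.1 (n + 1) then
          H (r.2.1, r.2.2, r.1) else 0 := fun n =>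
      measurable_ite_le_lt (by fun_prop) (by fun_prop) (by fun_prop) (by fun_prop)
    have hite' : Measurable fun r : ((ℝ × Y) × (Y × ℝ)) × (ℕ → Y × ℝ) =>
        if arrival (consSeq (r.1.2, r.2)) (n + 1) ≤ r.1.1.1 ∧
            r.1.1.1 < arrival (consSeq (r.1.2, r.2)) (n + 1 + 1) then
          H (r.1.1.1, r.1.1.2, consSeq (r.1.2, r.2)) else 0 :=
      (hite (n + 1)).comp (f := fun r : ((ℝ × Y) × (Y × ℝ)) × (ℕ → Y × ℝ) =>
        (consSeq (r.1.2, r.2), r.1.1.1, r.1.1.2)) (by fun_prop)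
    rw [lintegral_infinitePi_cons _ _ (by fun_prop)]
    simp_rw [removePoint_succ_consSeq, arrival_consSeq, consSeq_succ]
    have hp : ∀ p : Y × ℝ, ∫⁻ w, H (p.2 + arrival w (n + 1), (w n).1,
        consSeq (p, removePoint n w)) ∂(poissonLaw M) =
        ∫⁻ u, ∫⁻ y, ∫⁻ w, (if arrival (consSeq (p, w)) (n + 1) ≤ u ∧
          u < arrival (consSeq (p, w)) (n + 1 + 1) then H (u, y, consSeq (p, w)) else 0)
          ∂(poissonLaw M) ∂M := by
      intro p
      rw [ih (fun r => H (p.2 + r.1, r.2.1, consSeq (p, r.2.2))) (by fun_prop)]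
      refine Eq.trans ?_ (lintegral_add_left_eq_self _ p.2)
      simp only [arrival_consSeq, add_le_add_iff_left, add_lt_add_iff_left]
    simp only [arrival_consSeq] at hp hite'
    simp_rw [hp]
    rw [lintegral_lintegral_swap (Measurable.aemeasurable
      (Measurable.lintegral_prod_right' (f := fun r : ((Y × ℝ) × ℝ) × Y => _)
      (Measurable.lintegral_prod_right' (f := fun r : (((Y × ℝ) × ℝ) × Y) × (ℕ → Y × ℝ) => _)
      (hite'.comp (f := fun r : (((Y × ℝ) × ℝ) × Y) × (ℕ → Y × ℝ) =>
        (((r.1.1.2, r.1.2), r.1.1.1), r.2)) (by fun_prop)))))]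
    refine lintegral_congr fun u => ?_
    rw [lintegral_lintegral_swap (Measurable.aemeasurable
      (Measurable.lintegral_prod_right' (f := fun r : ((Y × ℝ) × Y) × (ℕ → Y × ℝ) => _)
      (hite'.comp (f := fun r : ((Y × ℝ) × Y) × (ℕ → Y × ℝ) =>
        (((u, r.1.2), r.1.1), r.2)) (by fun_prop))))]
    refine lintegral_congr fun y => ?_
    refine Eq.trans ?_ (lintegral_infinitePi_cons _ _ ((hite (n + 1)).comp
      (f := fun w : ℕ → Y × ℝ => (w, u, y)) (by fun_prop))).symm
    simp only [Function.comp_apply, arrival_consSeq]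

lemma ae_gap_pos : ∀ᵐ w ∂(poissonLaw M), ∀ n, 0 < (w n).2 := by
  refine ae_all_iff.2 fun n => ?_
  have h1 : ∀ᵐ p ∂(M.prod (expMeasure 1)), 0 < p.2 :=
    Measure.quasiMeasurePreserving_snd.ae ae_pos_expMeasure
  have h2 := measurePreserving_eval_infinitePi (fun _ : ℕ => M.prod (expMeasure 1)) n
  exact h2.quasiMeasurePreserving.ae h1

lemma tsum_lintegral_removePoint (H : ℝ × Y × (ℕ → Y × ℝ) → ℝ≥0∞) (hH : Measurable H) :
    ∑' n, ∫⁻ w, H (arrival w (n + 1), (w n).1, removePoint n w) ∂(poissonLaw M) =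
      ∫⁻ u, ∫⁻ y, ∫⁻ w, ∑' n, (if arrival w n ≤ u ∧ u < arrival w (n + 1) then H (u, y, w) else 0)
        ∂(poissonLaw M) ∂M := by
  have hite : ∀ n, Measurable fun r : (ℝ × Y) × (ℕ → Y × ℝ) =>
      if arrival r.2 n ≤ r.1.1 ∧ r.1.1 < arrival r.2 (n + 1) then
        H (r.1.1, r.1.2, r.2) else 0 := fun n =>
    measurable_ite_le_lt (by fun_prop) (by fun_prop) (by fun_prop) (by fun_prop)
  simp_rw [lintegral_removePoint _ H hH]
  refine (lintegral_tsum fun n => Measurable.aemeasurable (Measurable.lintegral_prod_right'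
    (Measurable.lintegral_prod_right' (hite n)))).symm.trans ?_
  refine lintegral_congr fun u => ?_
  refine (lintegral_tsum fun n => Measurable.aemeasurable
    ((Measurable.lintegral_prod_right' (hite n)).comp measurable_prodMk_left)).symm.trans ?_
  refine lintegral_congr fun y => ?_
  exact (lintegral_tsum fun n => Measurable.aemeasurable
    ((hite n).comp measurable_prodMk_left)).symm

/-- Arrival times tend to infinity: on average at most `T` of them are below `T`, by the part of
the Mecke formula that only uses disjointness of the intervals between arrivals. -/
lemma ae_tendsto_arrival : ∀ᵐ w ∂(poissonLaw M), Tendsto (arrival w) atTop atTop := by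
  have key : ∀ T : ℕ, ∀ᵐ w ∂(poissonLaw M), ∃ n, (T : ℝ) < arrival w n := by
    intro T
    have hH : Measurable fun p : ℝ × Y × (ℕ → Y × ℝ) => if p.1 ≤ T then (1 : ℝ≥0∞) else 0 :=
      Measurable.ite (measurableSet_le (by fun_prop) (by fun_prop)) measurable_const
        measurable_const
    have h := tsum_lintegral_removePoint (M := M) _ hH
    have hle : ∫⁻ u : ℝ, ∫⁻ _ : Y, ∫⁻ w, ∑' n, (if arrival w n ≤ u ∧ u < arrival w (n + 1) then
        (if u ≤ T then (1 : ℝ≥0∞) else 0) else 0) ∂(poissonLaw M) ∂M ≤ ENNReal.ofReal T := by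
      calc _ ≤ ∫⁻ u : ℝ, (Set.Icc 0 (T : ℝ)).indicator 1 u := by
            refine lintegral_mono fun u => ?_
            have : ∀ᵐ w ∂(poissonLaw M), ∑' n, (if arrival w n ≤ u ∧ u < arrival w (n + 1) then
                (if u ≤ T then (1 : ℝ≥0∞) else 0) else 0) ≤ (Set.Icc 0 (T : ℝ)).indicator 1 u := by
              filter_upwards [ae_gap_pos] with w hw
              refine (tsum_arrival_le w hw u _).trans (le_of_eq ?_)
              simp only [Set.indicator, Set.mem_Icc, Pi.one_apply]
              split_ifs <;> simp_all
            refine (lintegral_mono fun _ => lintegral_mono_ae this).trans ?_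
            simp
        _ = ENNReal.ofReal T := by
            rw [lintegral_indicator_one measurableSet_Icc, Real.volume_Icc, sub_zero]
    have hm : ∀ n, Measurable fun w : ℕ → Y × ℝ =>
        if arrival w (n + 1) ≤ T then (1 : ℝ≥0∞) else 0 := fun n => hH.comp
      (f := fun w => (arrival w (n + 1), (w n).1, removePoint n w)) (by fun_prop)
    rw [← h, ← lintegral_tsum fun n => (hm n).aemeasurable] at hle
    have hfin := ae_lt_top (Measurable.tsum hm) (hle.trans_lt ENNReal.ofReal_lt_top).ne
    filter_upwards [hfin] with w hw
    by_contra hno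
    push Not at hno
    simp [hno] at hw
  filter_upwards [ae_all_iff.2 key, ae_gap_pos] with w hw hpos
  refine tendsto_atTop_atTop_of_monotone (arrival_mono hpos).monotone fun b => ?_
  obtain ⟨T, hT⟩ := exists_nat_ge b
  obtain ⟨n, hn⟩ := hw T
  exact ⟨n, hT.trans hn.le⟩

/-- The Mecke formula: summing over the points of a marked Poisson process a function of the point
and of the remaining configuration amounts to adding an independent point. -/
theorem mecke (H : ℝ × Y × (ℕ → Y × ℝ) → ℝ≥0∞) (hH : Measurable H) :
    ∑' n, ∫⁻ w, H (arrival w (n + 1), (w n).1, removePoint n w) ∂(poissonLaw M) =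
      ∫⁻ u in Set.Ici (0 : ℝ), ∫⁻ y, ∫⁻ w, H (u, y, w) ∂(poissonLaw M) ∂M := by
  rw [tsum_lintegral_removePoint H hH, ← lintegral_indicator measurableSet_Ici]
  refine lintegral_congr fun u => ?_
  have : ∀ y, ∫⁻ w, ∑' n, (if arrival w n ≤ u ∧ u < arrival w (n + 1) then H (u, y, w) else 0)
      ∂(poissonLaw M) = ∫⁻ w, (if 0 ≤ u then H (u, y, w) else 0) ∂(poissonLaw M) := by
    intro y
    refine lintegral_congr_ae ?_
    filter_upwards [ae_gap_pos, ae_tendsto_arrival] with w h1 h2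
    exact tsum_arrival_eq w h1 h2 u _
  simp_rw [this]
  by_cases h : 0 ≤ u <;> simp [h]

end Mecke

/-! ### The point of least score -/

section Argmin
open scoped Classical NNReal
variable {Y : Type*}

/-- The score `t / g(y)` of a point with arrival time `t` and mark `y`. For `t > 0` it is infinite
when `g(y) = 0`. -/
def score (g : Y → ℝ≥0) (t : ℝ) (y : Y) : ℝ≥0∞ := ENNReal.ofReal t / g y

/-- The score of the `i`-th point of a configuration. -/
def pointScore (g : Y → ℝ≥0) (w : ℕ → Y × ℝ) (i : ℕ) : ℝ≥0∞ :=
  score g (arrival w (i + 1)) (w i).1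

/-- The `n`-th point has a strictly smaller score than all others. -/
def IsArgmin (g : Y → ℝ≥0) (w : ℕ → Y × ℝ) (n : ℕ) : Prop :=
  ∀ i, i ≠ n → pointScore g w n < pointScore g w i

lemma IsArgmin.unique {g : Y → ℝ≥0} {w : ℕ → Y × ℝ} {n m : ℕ} (hn : IsArgmin g w n)
    (hm : IsArgmin g w m) : n = m := by
  by_contra h
  exact (hn m (Ne.symm h)).asymm (hm n h)

lemma tsum_isArgmin_eq {g : Y → ℝ≥0} {w : ℕ → Y × ℝ} {n : ℕ} (hn : IsArgmin g w n)
    (c : ℕ → ℝ≥0∞) : ∑' i, (if IsArgmin g w i then c i else 0) = c n := by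
  rw [tsum_eq_single n fun m hm => if_neg fun h => hm (h.unique hn), if_pos hn]

lemma tsum_isArgmin_le {g : Y → ℝ≥0} {w : ℕ → Y × ℝ} {c : ℕ → ℝ≥0∞} {C : ℝ≥0∞}
    (h : ∀ n, IsArgmin g w n → c n ≤ C) :
    ∑' i, (if IsArgmin g w i then c i else 0) ≤ C := by
  by_cases hex : ∃ n, IsArgmin g w n
  · obtain ⟨n, hn⟩ := hex
    rw [tsum_isArgmin_eq hn]
    exact h n hn
  · push Not at hex
    simp [hex]

lemma isArgmin_iff_removePoint {g : Y → ℝ≥0} {w : ℕ → Y × ℝ} {n : ℕ} :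
    IsArgmin g w n ↔ ∀ i, score g (arrival w (n + 1)) (w n).1 < pointScore g (removePoint n w) i :=
  (forall_point_removePoint n w fun t y => score g (arrival w (n + 1)) (w n).1 < score g t y).symm

/-- Change of variables `u = s g` for functions of the score. -/
lemma lintegral_score (g : Y → ℝ≥0) (y : Y) (φ : ℝ≥0∞ → ℝ≥0∞) (hφ : Measurable φ) (htop : φ ∞ = 0) :
    ∫⁻ u in Set.Ici (0 : ℝ), φ (score g u y) =
      g y * ∫⁻ s in Set.Ici (0 : ℝ), φ (ENNReal.ofReal s) := by
  by_cases h : g y = 0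
  · rw [h, ENNReal.coe_zero, zero_mul, lintegral_eq_zero_iff' (by unfold score; fun_prop)]
    have h0 : ∀ᵐ u : ℝ ∂volume.restrict (Set.Ici 0), u ≠ 0 :=
      ae_restrict_of_ae (Measure.ae_ne volume 0)
    filter_upwards [h0, ae_restrict_mem measurableSet_Ici] with u hu hu'
    have hpos : 0 < u := lt_of_le_of_ne hu' (Ne.symm hu)
    rw [score, h, ENNReal.coe_zero, ENNReal.div_zero (by simpa using hpos), htop]
    rfl
  · have hpos : 0 < g y := pos_iff_ne_zero.2 h
    have hinv : ((g y : ℝ)⁻¹) ≠ 0 := inv_ne_zero (by exact_mod_cast h)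
    rw [← lintegral_indicator measurableSet_Ici, ← lintegral_indicator measurableSet_Ici]
    have hm : Measurable fun s : ℝ => (Set.Ici (0 : ℝ)).indicator
        (fun s => φ (ENNReal.ofReal s)) s :=
      Measurable.indicator (by fun_prop) measurableSet_Ici
    conv_rhs => rw [← Real.smul_map_volume_mul_left hinv]
    rw [lintegral_smul_measure, lintegral_map hm (by fun_prop), smul_eq_mul, ← mul_assoc]
    have h1 : (g y : ℝ≥0∞) * ENNReal.ofReal |(g y : ℝ)⁻¹| = 1 := by
      rw [abs_of_nonneg (by positivity), ENNReal.ofReal_inv_of_pos (by exact_mod_cast hpos),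
        ENNReal.ofReal_coe_nnreal, ENNReal.mul_inv_cancel (by simpa using h) ENNReal.coe_ne_top]
    rw [h1, one_mul]
    refine lintegral_congr fun u => ?_
    have hiff : 0 ≤ (g y : ℝ)⁻¹ * u ↔ 0 ≤ u := by
      rw [mul_nonneg_iff_of_pos_left (by positivity)]
    by_cases hu : 0 ≤ u
    · rw [Set.indicator_of_mem (Set.mem_Ici.2 hu), Set.indicator_of_mem (Set.mem_Ici.2 (hiff.2 hu)),
        score, ENNReal.ofReal_mul (by positivity),
        ENNReal.ofReal_inv_of_pos (by exact_mod_cast hpos),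
        ENNReal.ofReal_coe_nnreal, mul_comm, ENNReal.div_eq_inv_mul, mul_comm]
    · rw [Set.indicator_of_notMem (by simpa using hu),
        Set.indicator_of_notMem (by simpa [hiff] using hu)]

variable [MeasurableSpace Y] {M : Measure Y} [IsProbabilityMeasure M] {g : Y → ℝ≥0}

lemma measurable_score (hg : Measurable g) : Measurable fun p : ℝ × Y => score g p.1 p.2 := by
  unfold score; fun_prop

lemma measurable_pointScore (hg : Measurable g) (i : ℕ) :
    Measurable fun w : ℕ → Y × ℝ => pointScore g w i :=
  (measurable_score hg).comp (f := fun w : ℕ → Y × ℝ => (arrival w (i + 1), (w i).1))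
    (by fun_prop)

lemma measurableSet_forall_lt_pointScore {α : Type*} [MeasurableSpace α] (hg : Measurable g)
    {s : α → ℝ≥0∞} {w : α → ℕ → Y × ℝ} (hs : Measurable s) (hw : Measurable w) :
    MeasurableSet {a | ∀ i, s a < pointScore g (w a) i} := by
  rw [Set.ofPred_forall]
  exact MeasurableSet.iInter fun i => measurableSet_lt hs ((measurable_pointScore hg i).comp hw)

lemma measurableSet_isArgmin (hg : Measurable g) (n : ℕ) :
    MeasurableSet {w : ℕ → Y × ℝ | IsArgmin g w n} := by
  unfold IsArgmin
  simp_rw [Set.ofPred_forall]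
  exact MeasurableSet.iInter fun i => MeasurableSet.iInter fun _ =>
    measurableSet_lt (measurable_pointScore hg n) (measurable_pointScore hg i)

/-- The probability that all scores exceed `s`. -/
def survival (M : Measure Y) [IsProbabilityMeasure M] (g : Y → ℝ≥0) (s : ℝ≥0∞) : ℝ≥0∞ :=
  poissonLaw M {w | ∀ i, s < pointScore g w i}

lemma antitone_survival : Antitone (survival M g) := fun _ _ h =>
  measure_mono fun _ hw i => h.trans_lt (hw i)

lemma survival_top : survival M g ∞ = 0 := by simp [survival]

/-- The Mecke formula applied to the point of least score. -/
lemma tsum_lintegral_isArgmin (hg : Measurable g) (G : ℝ × Y × (ℕ → Y × ℝ) → ℝ≥0∞)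
    (hG : Measurable G) :
    ∑' n, ∫⁻ w, (if IsArgmin g w n then G (arrival w (n + 1), (w n).1, removePoint n w) else 0)
        ∂(poissonLaw M) =
      ∫⁻ u in Set.Ici (0 : ℝ), ∫⁻ y, ∫⁻ w,
        (if ∀ i, score g u y < pointScore g w i then G (u, y, w) else 0) ∂(poissonLaw M) ∂M := by
  have hH : Measurable fun p : ℝ × Y × (ℕ → Y × ℝ) =>
      if ∀ i, score g p.1 p.2.1 < pointScore g p.2.2 i then G p else 0 :=
    Measurable.ite (measurableSet_forall_lt_pointScore hg
      ((measurable_score hg).comp (f := fun p : ℝ × Y × (ℕ → Y × ℝ) => (p.1, p.2.1)) (by fun_prop))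
      (by fun_prop)) hG measurable_const
  rw [← mecke _ hH]
  simp_rw [isArgmin_iff_removePoint]

/-- The score of the minimiser has density `survival` and is independent of its mark, whose law is
`g M`. -/
lemma tsum_lintegral_isArgmin_score (hg : Measurable g) (k : ℝ≥0∞ → ℝ≥0∞) (hk : Measurable k)
    (F : Y → ℝ≥0∞) (hF : Measurable F) :
    ∑' n, ∫⁻ w, (if IsArgmin g w n then k (pointScore g w n) * F (w n).1 else 0) ∂(poissonLaw M) =
      (∫⁻ y, F y * g y ∂M) *
        ∫⁻ s in Set.Ici (0 : ℝ), k (ENNReal.ofReal s) * survival M g (ENNReal.ofReal s) := by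
  have hsc := measurable_score hg
  have hS : Measurable (survival M g) := antitone_survival.measurable
  have h := tsum_lintegral_isArgmin (M := M) hg (fun p => k (score g p.1 p.2.1) * F p.2.1)
    ((hk.comp (hsc.comp (f := fun p : ℝ × Y × (ℕ → Y × ℝ) => (p.1, p.2.1)) (by fun_prop))).mul
      (by fun_prop))
  refine h.trans ?_
  have hin : ∀ u y, ∫⁻ w, (if ∀ i, score g u y < pointScore g w i then k (score g u y) * F y else 0)
      ∂(poissonLaw M) = F y * (k (score g u y) * survival M g (score g u y)) := by
    intro u y
    have hms : MeasurableSet {w : ℕ → Y × ℝ | ∀ i, score g u y < pointScore g w i} :=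
      measurableSet_forall_lt_pointScore hg measurable_const measurable_id
    have : (fun w : ℕ → Y × ℝ => if ∀ i, score g u y < pointScore g w i then
        k (score g u y) * F y else 0) =
        {w | ∀ i, score g u y < pointScore g w i}.indicator fun _ => k (score g u y) * F y := by
      ext w; simp [Set.indicator]
    rw [this, lintegral_indicator_const hms, survival]
    ring
  simp_rw [hin]
  have hm : Measurable fun p : ℝ × Y =>
      F p.2 * (k (score g p.1 p.2) * survival M g (score g p.1 p.2)) := by
    fun_prop
  rw [lintegral_lintegral_swap hm.aemeasurable, ← lintegral_mul_const _ (by fun_prop)]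
  refine lintegral_congr fun y => ?_
  rw [lintegral_const_mul _ (by fun_prop), mul_assoc,
    lintegral_score g y (fun s => k s * survival M g s) (by fun_prop) (by simp [survival_top])]

lemma lintegral_survival_le_one (hg : Measurable g) (hg1 : ∫⁻ y, g y ∂M = 1) :
    ∫⁻ s in Set.Ici (0 : ℝ), survival M g (ENNReal.ofReal s) ≤ 1 := by
  have h := tsum_lintegral_isArgmin_score (M := M) hg (fun _ => 1) measurable_const (fun _ => 1)
    measurable_const
  simp only [one_mul, hg1] at h
  rw [← h, ← lintegral_tsum fun n =>
    (Measurable.ite (measurableSet_isArgmin hg n) measurable_const measurable_const).aemeasurable]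
  calc _ ≤ ∫⁻ _ : ℕ → Y × ℝ, 1 ∂(poissonLaw M) :=
        lintegral_mono fun w => tsum_isArgmin_le fun _ _ => le_rfl
    _ = 1 := by simp

/-- The least score has mean at most one: its tail `∫_a^∞ survival` is at most `survival a`. -/
lemma lintegral_mul_survival_le_one (hg : Measurable g) (hg1 : ∫⁻ y, g y ∂M = 1) :
    ∫⁻ s in Set.Ici (0 : ℝ), ENNReal.ofReal s * survival M g (ENNReal.ofReal s) ≤ 1 := by
  have hS : Measurable (survival M g) := antitone_survival.measurable
  have htail : ∀ a : ℝ, ∫⁻ s in Set.Ici (0 : ℝ),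
      (if ENNReal.ofReal a < ENNReal.ofReal s then 1 else 0) * survival M g (ENNReal.ofReal s) ≤
        survival M g (ENNReal.ofReal a) := by
    intro a
    have hk : Measurable fun s : ℝ≥0∞ => if ENNReal.ofReal a < s then (1 : ℝ≥0∞) else 0 :=
      Measurable.ite measurableSet_Ioi measurable_const measurable_const
    have h := tsum_lintegral_isArgmin_score (M := M) hg _ hk (fun _ => 1) measurable_const
    simp only [one_mul, hg1, mul_one] at h
    have hms : MeasurableSet {w : ℕ → Y × ℝ | ∀ i, ENNReal.ofReal a < pointScore g w i} :=
      measurableSet_forall_lt_pointScore hg measurable_const measurable_id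
    have hk' : ∀ n, Measurable fun w : ℕ → Y × ℝ => if IsArgmin g w n then
        if ENNReal.ofReal a < pointScore g w n then (1 : ℝ≥0∞) else 0 else 0 := fun n =>
      Measurable.ite (measurableSet_isArgmin hg n) (hk.comp (measurable_pointScore hg n))
        measurable_const
    rw [← h, ← lintegral_tsum fun n => (hk' n).aemeasurable, survival,
      ← lintegral_indicator_one hms]
    refine lintegral_mono fun w => tsum_isArgmin_le fun n hn => ?_
    split_ifs with hlt
    · rw [Set.indicator_of_mem]
      · rfl
      · intro i
        by_cases hi : i = n
        · rw [hi]; exact hlt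
        · exact hlt.trans (hn i hi)
    · exact zero_le
  have hlen : ∀ s ∈ Set.Ici (0 : ℝ), ENNReal.ofReal s =
      ∫⁻ a in Set.Ici (0 : ℝ), if ENNReal.ofReal a < ENNReal.ofReal s then 1 else 0 := by
    intro s hs
    have : ∀ a ∈ Set.Ici (0 : ℝ), (if ENNReal.ofReal a < ENNReal.ofReal s then (1 : ℝ≥0∞) else 0) =
        (Set.Iio s).indicator 1 a := by
      intro a ha
      simp only [Set.indicator, Set.mem_Iio,
        ENNReal.ofReal_lt_ofReal_iff_of_nonneg ha, Pi.one_apply]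
    rw [setLIntegral_congr_fun measurableSet_Ici this, lintegral_indicator_one measurableSet_Iio,
      Measure.restrict_apply measurableSet_Iio, Set.inter_comm, Set.Ici_inter_Iio, Real.volume_Ico,
      sub_zero]
  calc _ = ∫⁻ s in Set.Ici (0 : ℝ), ∫⁻ a in Set.Ici (0 : ℝ),
        (if ENNReal.ofReal a < ENNReal.ofReal s then 1 else 0) *
          survival M g (ENNReal.ofReal s) := by
        refine setLIntegral_congr_fun measurableSet_Ici fun s hs => ?_
        rw [lintegral_mul_const _ (Measurable.ite (measurableSet_lt (by fun_prop) measurable_const)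
          measurable_const measurable_const), ← hlen s hs]
    _ = ∫⁻ a in Set.Ici (0 : ℝ), ∫⁻ s in Set.Ici (0 : ℝ),
        (if ENNReal.ofReal a < ENNReal.ofReal s then 1 else 0) *
          survival M g (ENNReal.ofReal s) := by
        refine lintegral_lintegral_swap (Measurable.aemeasurable ?_)
        exact (Measurable.ite (measurableSet_lt (by fun_prop) (by fun_prop)) measurable_const
          measurable_const).mul (by fun_prop)
    _ ≤ ∫⁻ a in Set.Ici (0 : ℝ), survival M g (ENNReal.ofReal a) := lintegral_mono htail
    _ ≤ 1 := lintegral_survival_le_one hg hg1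

/-- The mark of the point of least score has law at most `g M`. -/
lemma tsum_lintegral_isArgmin_le (hg : Measurable g) (hg1 : ∫⁻ y, g y ∂M = 1)
    (F : Y → ℝ≥0∞) (hF : Measurable F) :
    ∑' n, ∫⁻ w, (if IsArgmin g w n then F (w n).1 else 0) ∂(poissonLaw M) ≤ ∫⁻ y, F y * g y ∂M := by
  have h := tsum_lintegral_isArgmin_score (M := M) hg (fun _ => 1) measurable_const F hF
  simp only [one_mul] at h
  rw [h]
  exact mul_le_of_le_one_right zero_le (lintegral_survival_le_one hg hg1)

/-- Almost surely there is a point of strictly least score, and its score is finite. -/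
lemma ae_exists_isArgmin (hg : Measurable g) (hg1 : ∫⁻ y, g y ∂M = 1) :
    ∀ᵐ w ∂(poissonLaw M), ∃ n, IsArgmin g w n ∧ pointScore g w n ≠ ∞ := by
  have hsc := measurable_score hg
  -- On average, `T` points have score at most `T`.
  have hfin : ∀ T : ℕ, ∀ᵐ w ∂(poissonLaw M), {n | pointScore g w n ≤ T}.Finite := by
    intro T
    have hk : Measurable fun s : ℝ≥0∞ => if s ≤ T then (1 : ℝ≥0∞) else 0 :=
      Measurable.ite measurableSet_Iic measurable_const measurable_const
    have hH : Measurable fun p : ℝ × Y × (ℕ → Y × ℝ) =>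
        if score g p.1 p.2.1 ≤ T then (1 : ℝ≥0∞) else 0 :=
      hk.comp (hsc.comp (f := fun p : ℝ × Y × (ℕ → Y × ℝ) => (p.1, p.2.1)) (by fun_prop))
    have hm : ∀ n, Measurable fun w : ℕ → Y × ℝ => if pointScore g w n ≤ T then (1 : ℝ≥0∞) else 0 :=
      fun n => hk.comp (measurable_pointScore hg n)
    have h := mecke (M := M) _ hH
    have hR : ∫⁻ u in Set.Ici (0 : ℝ), ∫⁻ y, ∫⁻ _ : ℕ → Y × ℝ,
        (if score g u y ≤ T then (1 : ℝ≥0∞) else 0) ∂(poissonLaw M) ∂M ≤ ENNReal.ofReal T := by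
      simp only [lintegral_const, measure_univ, mul_one]
      have hks : Measurable (Function.uncurry fun u y =>
          if score g u y ≤ T then (1 : ℝ≥0∞) else 0) :=
        hk.comp hsc
      rw [lintegral_lintegral_swap hks.aemeasurable]
      simp_rw [lintegral_score g _ (fun s => if s ≤ T then (1 : ℝ≥0∞) else 0) hk (by simp)]
      rw [lintegral_mul_const _ (by fun_prop), hg1, one_mul]
      calc _ ≤ ∫⁻ s in Set.Ici (0 : ℝ), (Set.Iic (T : ℝ)).indicator 1 s := by
            refine lintegral_mono fun s => ?_
            split_ifs with h
            · rw [Set.indicator_of_mem]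
              · rfl
              · have : ENNReal.ofReal s ≤ ENNReal.ofReal T := by simpa using h
                exact (ENNReal.ofReal_le_ofReal_iff (Nat.cast_nonneg T)).1 this
            · exact zero_le
        _ = ENNReal.ofReal T := by
            rw [lintegral_indicator_one measurableSet_Iic, Measure.restrict_apply measurableSet_Iic,
              Set.inter_comm, Set.Ici_inter_Iic, Real.volume_Icc, sub_zero]
    have hsum : ∫⁻ w, ∑' n, (if pointScore g w n ≤ T then (1 : ℝ≥0∞) else 0) ∂(poissonLaw M) ≤
        ENNReal.ofReal T := by
      rw [lintegral_tsum fun n => (hm n).aemeasurable]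
      exact h.le.trans hR
    filter_upwards [ae_lt_top (Measurable.tsum hm) (hsum.trans_lt ENNReal.ofReal_lt_top).ne]
      with w hw
    by_contra hinf
    have hinf : {n | pointScore g w n ≤ T}.Infinite := hinf
    have := hinf.to_subtype
    have := ENNReal.tsum_const_eq_top_of_ne_zero (α := {n | pointScore g w n ≤ T}) one_ne_zero
    rw [tsum_subtype {n | pointScore g w n ≤ T} (fun _ => (1 : ℝ≥0∞))] at this
    refine hw.ne (Eq.trans (tsum_congr fun n => ?_) this)
    simp [Set.indicator]
  -- If all scores were infinite with positive probability, `∫ survival` would diverge.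
  have hex : ∀ᵐ w ∂(poissonLaw M), ∃ i, pointScore g w i ≠ ∞ := by
    have hc : poissonLaw M {w | ∀ i, pointScore g w i = ∞} * ∞ ≤ 1 := by
      refine le_trans ?_ (lintegral_survival_le_one hg hg1)
      have : poissonLaw M {w | ∀ i, pointScore g w i = ∞} * ∞ =
          ∫⁻ _ in Set.Ici (0 : ℝ), poissonLaw M {w | ∀ i, pointScore g w i = ∞} := by simp
      rw [this]
      refine lintegral_mono fun s => measure_mono fun w hw i => ?_
      rw [hw i]
      exact ENNReal.ofReal_lt_top
    rw [ae_iff]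
    push Not
    by_contra hne
    rw [ENNReal.mul_top hne] at hc
    simp at hc
  -- For a fixed mark and configuration, the arrival times that produce a tie are countably many.
  have hties : ∀ᵐ w ∂(poissonLaw M), ∀ n, pointScore g w n ≠ ∞ → ∀ i, i ≠ n →
      pointScore g w i ≠ pointScore g w n := by
    have hset : MeasurableSet {p : ℝ × Y × (ℕ → Y × ℝ) | score g p.1 p.2.1 ≠ ∞ ∧
        ¬ ∀ i, pointScore g p.2.2 i ≠ score g p.1 p.2.1} := by
      have h1 : Measurable fun p : ℝ × Y × (ℕ → Y × ℝ) => score g p.1 p.2.1 :=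
        hsc.comp (f := fun p : ℝ × Y × (ℕ → Y × ℝ) => (p.1, p.2.1)) (by fun_prop)
      have h2 : MeasurableSet {p : ℝ × Y × (ℕ → Y × ℝ) |
          ∀ i, pointScore g p.2.2 i ≠ score g p.1 p.2.1} := by
        rw [Set.ofPred_forall]
        exact MeasurableSet.iInter fun i => (measurableSet_eq_fun
          ((measurable_pointScore hg i).comp (by fun_prop)) h1).compl
      exact (measurableSet_eq_fun h1 measurable_const).compl.inter h2.compl
    have hH : Measurable fun p : ℝ × Y × (ℕ → Y × ℝ) => if score g p.1 p.2.1 ≠ ∞ ∧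
        ¬ ∀ i, pointScore g p.2.2 i ≠ score g p.1 p.2.1 then (1 : ℝ≥0∞) else 0 :=
      Measurable.ite hset measurable_const measurable_const
    have h := mecke (M := M) _ hH
    have hzero : ∀ y w, ∫⁻ u in Set.Ici (0 : ℝ), (if score g u y ≠ ∞ ∧
        ¬ ∀ i, pointScore g w i ≠ score g u y then (1 : ℝ≥0∞) else 0) = 0 := by
      intro y w
      have hcount :
          (insert 0 (Set.range fun i => (g y : ℝ) * (pointScore g w i).toReal)).Countable :=
        (Set.countable_range _).insert 0
      have hae : ∀ᵐ u : ℝ ∂volume.restrict (Set.Ici 0),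
          u ∉ insert 0 (Set.range fun i => (g y : ℝ) * (pointScore g w i).toReal) :=
        ae_restrict_of_ae (hcount.ae_notMem volume)
      refine (lintegral_congr_ae ?_).trans (lintegral_zero (μ := volume.restrict (Set.Ici (0 : ℝ))))
      filter_upwards [hae, ae_restrict_mem measurableSet_Ici] with u hu hu0
      rw [if_neg]
      rintro ⟨htop, hi⟩
      push Not at hi
      obtain ⟨i, hi⟩ := hi
      have hupos : 0 < u := lt_of_le_of_ne hu0 fun h => hu (by simp [← h])
      have hgy : g y ≠ 0 := by
        intro h0
        apply htop
        rw [score, h0, ENNReal.coe_zero, ENNReal.div_zero (by simpa using hupos)]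
      apply hu
      refine Set.mem_insert_of_mem _ ⟨i, ?_⟩
      have hgy' : (g y : ℝ) ≠ 0 := by exact_mod_cast hgy
      simp only [hi, score, ENNReal.toReal_div, ENNReal.toReal_ofReal hupos.le, ENNReal.coe_toReal]
      field_simp
    have hR : ∫⁻ u in Set.Ici (0 : ℝ), ∫⁻ y, ∫⁻ w, (if score g u y ≠ ∞ ∧
        ¬ ∀ i, pointScore g w i ≠ score g u y then (1 : ℝ≥0∞) else 0) ∂(poissonLaw M) ∂M = 0 := by
      rw [lintegral_lintegral_swap (Measurable.aemeasurable (Measurable.lintegral_prod_right'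
        (f := fun r : (ℝ × Y) × (ℕ → Y × ℝ) => if score g r.1.1 r.1.2 ≠ ∞ ∧
          ¬ ∀ i, pointScore g r.2 i ≠ score g r.1.1 r.1.2 then (1 : ℝ≥0∞) else 0)
        (hH.comp (f := fun r : (ℝ × Y) × (ℕ → Y × ℝ) => (r.1.1, r.1.2, r.2)) (by fun_prop))))]
      refine (lintegral_congr fun y => ?_).trans (lintegral_zero (μ := M))
      have hHy : Measurable (Function.uncurry fun (u : ℝ) (w : ℕ → Y × ℝ) => if score g u y ≠ ∞ ∧
          ¬ ∀ i, pointScore g w i ≠ score g u y then (1 : ℝ≥0∞) else 0) :=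
        hH.comp (f := fun r : ℝ × (ℕ → Y × ℝ) => (r.1, y, r.2)) (by fun_prop)
      rw [lintegral_lintegral_swap hHy.aemeasurable]
      exact (lintegral_congr fun w => hzero y w).trans lintegral_zero
    refine ae_all_iff.2 fun n => ?_
    have hn := ENNReal.tsum_eq_zero.1 (h.trans hR) n
    have hHn : Measurable fun w : ℕ → Y × ℝ => if pointScore g w n ≠ ∞ ∧
        ¬ ∀ i, pointScore g (removePoint n w) i ≠ pointScore g w n then (1 : ℝ≥0∞) else 0 :=
      hH.comp (f := fun w : ℕ → Y × ℝ => (arrival w (n + 1), (w n).1, removePoint n w))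
        (by fun_prop)
    have hn := (lintegral_eq_zero_iff hHn).1 hn
    filter_upwards [hn] with w hw htop
    have hw : ¬ (pointScore g w n ≠ ∞ ∧
        ¬ ∀ i, pointScore g (removePoint n w) i ≠ pointScore g w n) := by
      intro hc
      have := (if_pos hc).symm.trans hw
      simp at this
    have hw : ∀ i, pointScore g (removePoint n w) i ≠ pointScore g w n := by
      by_contra hno
      exact hw ⟨htop, hno⟩
    exact (forall_point_removePoint n w fun t y => score g t y ≠ pointScore g w n).1 hw
  filter_upwards [ae_all_iff.2 hfin, hex, hties] with w h1 h2 h3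
  obtain ⟨i0, hi0⟩ := h2
  obtain ⟨T, hT⟩ := ENNReal.exists_nat_gt hi0
  obtain ⟨n, hn, hmin⟩ := Set.exists_min_image _ (pointScore g w) (h1 T) ⟨i0, hT.le⟩
  have hntop : pointScore g w n ≠ ∞ := ne_top_of_le_ne_top (ENNReal.natCast_ne_top T) hn
  refine ⟨n, fun i hi => lt_of_le_of_ne ?_ (h3 n hntop i hi).symm, hntop⟩
  by_cases hiT : pointScore g w i ≤ T
  · exact hmin i hiT
  · exact le_trans hn (not_le.1 hiT).le

end Argmin

/-! ### The index of the selected point within its bin -/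

section Rank
open scoped Classical NNReal
variable {Y ι : Type*}

/-- The number of points before the `n`-th one that lie in the same bin. -/
def earlierInBin (b : Y → ι) (w : ℕ → Y × ℝ) (n : ℕ) : ℕ :=
  ∑ i ∈ Finset.range n, if b (w i).1 = b (w n).1 then 1 else 0

variable [MeasurableSpace Y] {M : Measure Y} {g : Y → ℝ≥0}
  [MeasurableSpace ι] [Countable ι] [MeasurableSingletonClass ι] {b : Y → ι}

lemma measurable_measure_bin (hb : Measurable b) : Measurable fun y => M {y' | b y' = b y} :=
  (measurable_of_countable fun j => M {y' | b y' = j}).comp hb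

variable [IsProbabilityMeasure M]

lemma measurable_earlierInBin (hb : Measurable b) (n : ℕ) :
    Measurable fun w : ℕ → Y × ℝ => earlierInBin b w n :=
  Finset.measurable_sum _ fun i _ => Measurable.ite
    (measurableSet_eq_fun (f := fun w : ℕ → Y × ℝ => b (w i).1) (g := fun w => b (w n).1)
      (by fun_prop) (by fun_prop)) measurable_const measurable_const

lemma measurableSet_le_and_eq {α : Type*} [MeasurableSpace α] {t u : α → ℝ} {c d : α → ι}
    (ht : Measurable t) (hu : Measurable u) (hc : Measurable c) (hd : Measurable d) :
    MeasurableSet {a | t a ≤ u a ∧ c a = d a} :=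
  (measurableSet_le ht hu).inter (measurableSet_eq_fun hc hd)

/-- Points of bin `j` before time `u` when all scores exceed `s`: removing such a point by the Mecke
formula leaves a configuration all of whose scores still exceed `s`. -/
lemma lintegral_count_le (hg : Measurable g) (hb : Measurable b) (s : ℝ≥0∞) (u : ℝ) (j : ι) :
    ∫⁻ w, (if ∀ i, s < pointScore g w i then
        ∑' i, (if arrival w (i + 1) ≤ u ∧ b (w i).1 = j then (1 : ℝ≥0∞) else 0) else 0)
      ∂(poissonLaw M) ≤ ENNReal.ofReal u * M {y | b y = j} * survival M g s := by
  have hms : MeasurableSet {w : ℕ → Y × ℝ | ∀ i, s < pointScore g w i} :=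
    measurableSet_forall_lt_pointScore hg measurable_const measurable_id
  have hbj : MeasurableSet {y | b y = j} := hb (measurableSet_singleton j)
  have hset : MeasurableSet {p : ℝ × Y × (ℕ → Y × ℝ) |
      (p.1 ≤ u ∧ b p.2.1 = j) ∧ ∀ i, s < pointScore g p.2.2 i} :=
    (measurableSet_le_and_eq (t := fun p : ℝ × Y × (ℕ → Y × ℝ) => p.1) (c := fun p => b p.2.1)
      (by fun_prop) measurable_const (by fun_prop) measurable_const).inter
      (measurableSet_forall_lt_pointScore hg measurable_const
        (w := fun p : ℝ × Y × (ℕ → Y × ℝ) => p.2.2) (by fun_prop))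
  have hH : Measurable fun p : ℝ × Y × (ℕ → Y × ℝ) =>
      if (p.1 ≤ u ∧ b p.2.1 = j) ∧ ∀ i, s < pointScore g p.2.2 i then (1 : ℝ≥0∞) else 0 :=
    Measurable.ite hset measurable_const measurable_const
  have hHi : ∀ i, Measurable fun w : ℕ → Y × ℝ => if (arrival w (i + 1) ≤ u ∧ b (w i).1 = j) ∧
      ∀ k, s < pointScore g (removePoint i w) k then (1 : ℝ≥0∞) else 0 := fun i =>
    hH.comp (f := fun w : ℕ → Y × ℝ => (arrival w (i + 1), (w i).1, removePoint i w)) (by fun_prop)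
  calc _ ≤ ∫⁻ w, ∑' i, (if (arrival w (i + 1) ≤ u ∧ b (w i).1 = j) ∧
          ∀ k, s < pointScore g (removePoint i w) k then (1 : ℝ≥0∞) else 0) ∂(poissonLaw M) := by
        refine lintegral_mono fun w => ?_
        split_ifs with h
        · refine ENNReal.tsum_le_tsum fun i => le_of_eq ?_
          have := (forall_point_removePoint i w fun t y => s < score g t y).2 fun k _ => h k
          have : ∀ k, s < pointScore g (removePoint i w) k := this
          simp [this]
        · exact zero_le
    _ = ∫⁻ v in Set.Ici (0 : ℝ), ∫⁻ y, ∫⁻ w, (if (v ≤ u ∧ b y = j) ∧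
          ∀ k, s < pointScore g w k then (1 : ℝ≥0∞) else 0) ∂(poissonLaw M) ∂M := by
        rw [lintegral_tsum fun i => (hHi i).aemeasurable]
        exact mecke _ hH
    _ = ∫⁻ v in Set.Ici (0 : ℝ),
          (Set.Iic u).indicator (fun _ => M {y | b y = j} * survival M g s) v := by
        refine lintegral_congr fun v => ?_
        have hin : ∀ y, ∫⁻ w, (if (v ≤ u ∧ b y = j) ∧
            ∀ k, s < pointScore g w k then (1 : ℝ≥0∞) else 0) ∂(poissonLaw M) =
            (if v ≤ u then survival M g s else 0) * {y | b y = j}.indicator 1 y := by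
          intro y
          by_cases hv : v ≤ u <;> by_cases hy : b y = j
          · simp only [hv, hy, true_and, survival]
            rw [← lintegral_indicator_one hms]
            simp [Set.indicator, hy]
          all_goals simp [hv, hy]
        simp_rw [hin]
        rw [lintegral_const_mul _ (measurable_one.indicator hbj), lintegral_indicator_one hbj]
        by_cases hv : v ≤ u <;> simp [hv, mul_comm]
    _ = ENNReal.ofReal u * M {y | b y = j} * survival M g s := by
        rw [lintegral_indicator_const measurableSet_Iic, Measure.restrict_apply measurableSet_Iic,
          Set.inter_comm, Set.Ici_inter_Iic, Real.volume_Icc, sub_zero]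
        ring

/-- The expected number of earlier points in the bin of the point of least score: given its mark `y`
and score `s`, it arrives at time `s g(y)`, before which its bin has received at most
`s g(y) M(bin)` points on average. -/
lemma tsum_lintegral_earlierInBin_le (hg : Measurable g) (hg1 : ∫⁻ y, g y ∂M = 1)
    (hb : Measurable b) (F : Y → ℝ≥0∞) (hF : Measurable F) :
    ∑' n, ∫⁻ w, (if IsArgmin g w n then F (w n).1 * earlierInBin b w n else 0) ∂(poissonLaw M) ≤
      ∫⁻ y, F y * (g y * M {y' | b y' = b y}) * g y ∂M := by
  have hsc := measurable_score hg
  have hS : Measurable (survival M g) := antitone_survival.measurable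
  have hbin := measurable_measure_bin (M := M) hb
  have hG : Measurable fun p : ℝ × Y × (ℕ → Y × ℝ) => F p.2.1 *
      ∑' i, (if arrival p.2.2 (i + 1) ≤ p.1 ∧ b (p.2.2 i).1 = b p.2.1 then (1 : ℝ≥0∞) else 0) := by
    refine Measurable.mul (by fun_prop) (Measurable.tsum fun i => ?_)
    exact Measurable.ite (measurableSet_le_and_eq (by fun_prop) (by fun_prop) (by fun_prop)
      (by fun_prop)) measurable_const measurable_const
  calc _ ≤ ∑' n, ∫⁻ w, (if IsArgmin g w n then F (w n).1 *
          ∑' i, (if arrival (removePoint n w) (i + 1) ≤ arrival w (n + 1) ∧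
            b (removePoint n w i).1 = b (w n).1 then (1 : ℝ≥0∞) else 0) else 0)
          ∂(poissonLaw M) := by
        refine ENNReal.tsum_le_tsum fun n => lintegral_mono_ae ?_
        filter_upwards [ae_gap_pos] with w hw
        split_ifs
        · gcongr
          refine le_trans (le_of_eq ?_) (sum_lt_le_tsum_removePoint n w fun t y =>
            if t ≤ arrival w (n + 1) ∧ b y = b (w n).1 then 1 else 0)
          rw [earlierInBin, Nat.cast_sum]
          refine Finset.sum_congr rfl fun i hi => ?_
          have : arrival w (i + 1) ≤ arrival w (n + 1) :=
            (arrival_mono hw).monotone (by have := Finset.mem_range.1 hi; omega)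
          simp [this]
        · exact le_rfl
    _ = ∫⁻ u in Set.Ici (0 : ℝ), ∫⁻ y, ∫⁻ w, (if ∀ i, score g u y < pointScore g w i then F y *
          ∑' i, (if arrival w (i + 1) ≤ u ∧ b (w i).1 = b y then (1 : ℝ≥0∞) else 0) else 0)
          ∂(poissonLaw M) ∂M := tsum_lintegral_isArgmin hg _ hG
    _ ≤ ∫⁻ u in Set.Ici (0 : ℝ), ∫⁻ y, F y * (g y * M {y' | b y' = b y}) *
          (score g u y * survival M g (score g u y)) ∂M := by
        refine setLIntegral_mono' measurableSet_Ici fun u hu => lintegral_mono fun y => ?_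
        have hms : MeasurableSet {w : ℕ → Y × ℝ | ∀ i, score g u y < pointScore g w i} :=
          measurableSet_forall_lt_pointScore hg measurable_const measurable_id
        have hmt : Measurable fun w : ℕ → Y × ℝ => if ∀ i, score g u y < pointScore g w i then
            ∑' i, (if arrival w (i + 1) ≤ u ∧ b (w i).1 = b y then (1 : ℝ≥0∞) else 0) else 0 := by
          refine Measurable.ite hms (Measurable.tsum fun i => ?_) measurable_const
          exact Measurable.ite (measurableSet_le_and_eq (by fun_prop) (by fun_prop) (by fun_prop)
            (by fun_prop)) measurable_const measurable_const
        simp only [← mul_ite_zero]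
        rw [lintegral_const_mul _ hmt, mul_assoc]
        gcongr
        refine (lintegral_count_le hg hb _ u (b y)).trans (le_of_eq ?_)
        -- For `g y = 0` and `u > 0` the score is infinite, so that both sides vanish.
        have hu' : ENNReal.ofReal u * survival M g (score g u y) =
            g y * (score g u y * survival M g (score g u y)) := by
          by_cases hgy : g y = 0
          · rcases eq_or_ne u 0 with rfl | hu0
            · simp [hgy]
            · have hpos : 0 < u := lt_of_le_of_ne hu (Ne.symm hu0)
              have : score g u y = ∞ := by
                rw [score, hgy, ENNReal.coe_zero, ENNReal.div_zero (by simpa using hpos)]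
              rw [this, survival_top, mul_zero, mul_zero, mul_zero]
          · rw [← mul_assoc, score, ENNReal.mul_div_cancel (by simpa using hgy) ENNReal.coe_ne_top]
        calc _ = M {y' | b y' = b y} * (ENNReal.ofReal u * survival M g (score g u y)) := by ring
          _ = _ := by rw [hu']; ring
    _ = (∫⁻ y, F y * (g y * M {y' | b y' = b y}) * g y ∂M) *
          ∫⁻ s in Set.Ici (0 : ℝ), ENNReal.ofReal s * survival M g (ENNReal.ofReal s) := by
        have hFg : Measurable fun y => F y * (g y * M {y' | b y' = b y}) :=
          hF.mul (hg.coe_nnreal_ennreal.mul hbin)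
        have hm : Measurable (Function.uncurry fun u y => F y * (g y * M {y' | b y' = b y}) *
            (score g u y * survival M g (score g u y))) := by
          have : Measurable fun p : ℝ × Y => score g p.1 p.2 * survival M g (score g p.1 p.2) := by
            fun_prop
          exact (hFg.comp measurable_snd).mul this
        have hFgg : Measurable fun y => F y * (g y * M {y' | b y' = b y}) * g y :=
          hFg.mul hg.coe_nnreal_ennreal
        rw [lintegral_lintegral_swap hm.aemeasurable, ← lintegral_mul_const _ hFgg]
        refine lintegral_congr fun y => ?_
        rw [lintegral_const_mul _ (by unfold score; fun_prop), mul_assoc (F y * _),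
          lintegral_score g y (fun s => s * survival M g s) (by fun_prop) (by simp [survival_top])]
    _ ≤ _ := mul_le_of_le_one_right zero_le (lintegral_mul_survival_le_one hg hg1)

/-- The tangent bound `log (c + 1) ≤ log A + (c + 1) / A - 1`, arranged without subtraction. -/
lemma ofReal_log_add_one_le (c : ℕ) {A : ℝ} (hA : 1 ≤ A) :
    ENNReal.ofReal (Real.log ((c : ℝ) + 1)) + 1 ≤ ENNReal.ofReal (Real.log A) +
      ENNReal.ofReal A⁻¹ + ENNReal.ofReal A⁻¹ * c := by
  have hA0 : 0 < A := by linarith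
  have hc : (0 : ℝ) < c + 1 := by positivity
  have hlogc : 0 ≤ Real.log ((c : ℝ) + 1) :=
    Real.log_nonneg (by linarith [(Nat.cast_nonneg c : (0 : ℝ) ≤ c)])
  have h := Real.log_le_sub_one_of_pos (div_pos hc hA0)
  rw [Real.log_div hc.ne' hA0.ne'] at h
  rw [← ENNReal.ofReal_one, ← ENNReal.ofReal_natCast c, ← ENNReal.ofReal_add hlogc zero_le_one,
    ← ENNReal.ofReal_mul (by positivity), ← ENNReal.ofReal_add (Real.log_nonneg hA) (by positivity),
    ← ENNReal.ofReal_add (add_nonneg (Real.log_nonneg hA) (by positivity)) (by positivity)]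
  refine ENNReal.ofReal_le_ofReal ?_
  have : ((c : ℝ) + 1) / A = A⁻¹ + A⁻¹ * c := by field_simp; ring
  linarith

/-- The expected logarithm of the index of the selected sample within its bin. -/
theorem tsum_lintegral_log_earlierInBin_le (hg : Measurable g) (hg1 : ∫⁻ y, g y ∂M = 1)
    (hb : Measurable b) :
    ∑' n, ∫⁻ w, (if IsArgmin g w n then
        ENNReal.ofReal (Real.log ((earlierInBin b w n : ℝ) + 1)) else 0) ∂(poissonLaw M) ≤
      ∫⁻ y, ENNReal.ofReal (Real.log (1 + g y * M.real {y' | b y' = b y})) * g y ∂M := by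
  have hbin := measurable_measure_bin (M := M) hb
  set A : Y → ℝ := fun y => 1 + g y * M.real {y' | b y' = b y} with hAdef
  have hA1 : ∀ y, 1 ≤ A y := fun y => by
    have : 0 ≤ (g y : ℝ) * M.real {y' | b y' = b y} := by positivity
    linarith
  have hAm : Measurable A := by
    have : Measurable fun y => M.real {y' | b y' = b y} := hbin.ennreal_toReal
    fun_prop
  have hcm : ∀ n, Measurable fun w : ℕ → Y × ℝ => (earlierInBin b w n : ℝ≥0∞) := fun n =>
    (measurable_of_countable fun k : ℕ => (k : ℝ≥0∞)).comp (measurable_earlierInBin hb n)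
  have hlm : ∀ n, Measurable fun w : ℕ → Y × ℝ =>
      ENNReal.ofReal (Real.log ((earlierInBin b w n : ℝ) + 1)) := fun n =>
    (measurable_of_countable fun k : ℕ => ENNReal.ofReal (Real.log ((k : ℝ) + 1))).comp
      (measurable_earlierInBin hb n)
  -- The minimiser exists almost surely; this total mass pays for the `- 1` of the tangent bound.
  have hone : ∑' n, ∫⁻ w, (if IsArgmin g w n then (1 : ℝ≥0∞) else 0) ∂(poissonLaw M) = 1 := by
    rw [← lintegral_tsum fun n => (Measurable.ite (measurableSet_isArgmin hg n) measurable_const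
      measurable_const).aemeasurable]
    calc _ = ∫⁻ _ : ℕ → Y × ℝ, 1 ∂(poissonLaw M) := by
          refine lintegral_congr_ae ?_
          filter_upwards [ae_exists_isArgmin hg hg1] with w hw
          obtain ⟨n, hn, -⟩ := hw
          exact tsum_isArgmin_eq hn _
      _ = 1 := by simp
  have hmite : ∀ (f : ℕ → (ℕ → Y × ℝ) → ℝ≥0∞), (∀ n, Measurable (f n)) → ∀ n,
      Measurable fun w => if IsArgmin g w n then f n w else 0 := fun f hf n =>
    Measurable.ite (measurableSet_isArgmin hg n) (hf n) measurable_const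
  have hadd : ∀ (f f' : ℕ → (ℕ → Y × ℝ) → ℝ≥0∞), (∀ n, Measurable (f n)) →
      ∑' n, ∫⁻ w, (if IsArgmin g w n then f n w + f' n w else 0) ∂(poissonLaw M) =
      ∑' n, ∫⁻ w, (if IsArgmin g w n then f n w else 0) ∂(poissonLaw M) +
      ∑' n, ∫⁻ w, (if IsArgmin g w n then f' n w else 0) ∂(poissonLaw M) := by
    intro f f' hf
    rw [← ENNReal.tsum_add]
    refine tsum_congr fun n => ?_
    rw [← lintegral_add_left (hmite f hf n)]
    refine lintegral_congr fun w => ?_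
    split_ifs <;> simp
  rw [← ENNReal.add_le_add_iff_right (a := 1) ENNReal.one_ne_top]
  calc _ = ∑' n, ∫⁻ w, (if IsArgmin g w n then
          ENNReal.ofReal (Real.log ((earlierInBin b w n : ℝ) + 1)) + 1 else 0) ∂(poissonLaw M) := by
        rw [hadd _ (fun _ _ => 1) hlm, hone]
    _ ≤ ∑' n, ∫⁻ w, (if IsArgmin g w n then ENNReal.ofReal (Real.log (A (w n).1)) +
          ENNReal.ofReal (A (w n).1)⁻¹ + ENNReal.ofReal (A (w n).1)⁻¹ * earlierInBin b w n else 0)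
          ∂(poissonLaw M) := by
        refine ENNReal.tsum_le_tsum fun n => lintegral_mono fun w => ?_
        split_ifs
        · exact ofReal_log_add_one_le _ (hA1 _)
        · exact le_rfl
    _ ≤ ∫⁻ y, ENNReal.ofReal (Real.log (A y)) * g y ∂M + ∫⁻ y, ENNReal.ofReal (A y)⁻¹ * g y ∂M +
          ∫⁻ y, ENNReal.ofReal (A y)⁻¹ * (g y * M {y' | b y' = b y}) * g y ∂M := by
        rw [hadd _ _ fun n => by fun_prop, hadd _ _ fun n => by fun_prop]
        gcongr
        · exact tsum_lintegral_isArgmin_le hg hg1 (fun y => ENNReal.ofReal (Real.log (A y)))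
            (by fun_prop)
        · exact tsum_lintegral_isArgmin_le hg hg1 (fun y => ENNReal.ofReal (A y)⁻¹) (by fun_prop)
        · exact tsum_lintegral_earlierInBin_le hg hg1 hb (fun y => ENNReal.ofReal (A y)⁻¹)
            (by fun_prop)
    _ = _ := by
        rw [add_assoc]
        congr 1
        rw [← lintegral_add_left (by fun_prop), ← hg1]
        refine lintegral_congr fun y => ?_
        have hA0 : 0 < A y := by linarith [hA1 y]
        have h1 : ENNReal.ofReal (A y) = 1 + g y * M {y' | b y' = b y} := by
          rw [hAdef, ENNReal.ofReal_add zero_le_one (by positivity), ENNReal.ofReal_one,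
            ENNReal.ofReal_mul (by positivity), ENNReal.ofReal_coe_nnreal, ofReal_measureReal]
        have h2 : ENNReal.ofReal (A y)⁻¹ * (1 + g y * M {y' | b y' = b y}) = 1 := by
          rw [← h1, ← ENNReal.ofReal_mul (by positivity), inv_mul_cancel₀ hA0.ne',
            ENNReal.ofReal_one]
        calc _ = ENNReal.ofReal (A y)⁻¹ * (1 + g y * M {y' | b y' = b y}) * g y := by ring
          _ = g y := by rw [h2, one_mul]

end Rank

/-! ### The encoder selects the point of least score -/

section Encoder
open scoped NNReal
variable {𝓩 : Type*} {J : ℕ}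

open scoped Classical in
/-- The number of the first `n` bin indices that are equal to `j`. -/
def binCount {ι : Type*} (js : ℕ → ι) (n : ℕ) (j : ι) : ℕ :=
  ∑ i ∈ Finset.range n, if js i = j then 1 else 0

/-- The pair `(j_n, ñ_{j_n})` of the `n`-th iteration. -/
def sampleIndex {ι : Type*} (js : ℕ → ι) (n : ℕ) : ι × ℕ := (js n, binCount js n (js n) + 1)

/-- The marked point process of a run: the `n`-th mark consists of the bin `j_n` and the sample
`z_n`. -/
def markedPoints (ω : Randomness 𝓩 J) (n : ℕ) : (Fin J × 𝓩) × ℝ :=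
  ((ω.2.1 n, ω.2.2 (sampleIndex ω.2.1 n)), ω.1 n)

/-- The density ratio `q(z) / (J π(j) p(z))` of target and proposal at the mark `(j, z)`. -/
def gain (p q : 𝓩 → ℝ≥0∞) (π : Fin J → ℝ≥0∞) (y : Fin J × 𝓩) : ℝ≥0 :=
  (q y.2 / p y.2 * ((J : ℝ≥0∞)⁻¹ / π y.1)).toNNReal

/-- A mark at which none of the quantities computed by the encoder is degenerate. -/
structure RegularMark [MeasurableSpace 𝓩] {ν : Measure 𝓩} {p : 𝓩 → ℝ≥0∞} (B : BinSystem ν p J)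
    (q : 𝓩 → ℝ≥0∞) (π : Fin J → ℝ≥0∞) (y : Fin J × 𝓩) : Prop where
  weight_ne_zero : π y.1 ≠ 0
  weight_ne_top : π y.1 ≠ ∞
  mem_region : y.2 ∈ B.region y.1
  source_ne_zero : p y.2 ≠ 0
  source_ne_top : p y.2 ≠ ∞
  target_ne_top : q y.2 ≠ ∞

variable [MeasurableSpace 𝓩] {ν : Measure 𝓩} {p : 𝓩 → ℝ≥0∞} {B : BinSystem ν p J}
  {q : 𝓩 → ℝ≥0∞} {π : Fin J → ℝ≥0∞} {y : Fin J × 𝓩}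

lemma RegularMark.natCast_ne_zero (_ : RegularMark B q π y) : (J : ℝ≥0∞) ≠ 0 := by
  have := y.1.pos
  exact_mod_cast this.ne'

lemma RegularMark.coe_gain (h : RegularMark B q π y) :
    (gain p q π y : ℝ≥0∞) = q y.2 / p y.2 * ((J : ℝ≥0∞)⁻¹ / π y.1) := by
  refine ENNReal.coe_toNNReal (ENNReal.mul_ne_top ?_ ?_)
  · exact ENNReal.div_ne_top h.target_ne_top h.source_ne_zero
  · exact ENNReal.div_ne_top (ENNReal.inv_ne_top.2 h.natCast_ne_zero) h.weight_ne_zero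

lemma RegularMark.score_eq (h : RegularMark B q π y) {t : ℝ} (ht : 0 < t) :
    score (gain p q π) t y = J * π y.1 * ENNReal.ofReal t * p y.2 / q y.2 := by
  have hJ := h.natCast_ne_zero
  have ht' : ENNReal.ofReal t ≠ 0 := by simpa using ht
  rw [score, h.coe_gain]
  by_cases hq : q y.2 = 0
  · rw [hq, ENNReal.zero_div, zero_mul, ENNReal.div_zero ht', ENNReal.div_zero]
    exact mul_ne_zero (mul_ne_zero (mul_ne_zero hJ h.weight_ne_zero) ht') h.source_ne_zero
  · have hq1 := h.target_ne_top
    have h1 : q y.2 / p y.2 ≠ 0 := (ENNReal.div_pos hq h.source_ne_top).ne'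
    have h2 : q y.2 / p y.2 ≠ ∞ := ENNReal.div_ne_top hq1 h.source_ne_zero
    rw [div_eq_mul_inv, ENNReal.mul_inv (Or.inl h1) (Or.inl h2),
      ENNReal.inv_div (Or.inl h.source_ne_top) (Or.inl h.source_ne_zero),
      ENNReal.inv_div (Or.inl h.weight_ne_top) (Or.inl h.weight_ne_zero)]
    simp only [div_eq_mul_inv, inv_inv]
    ring

lemma RegularMark.div_ratioBound_le_score (h : RegularMark B q π y) (t : ℝ) :
    ENNReal.ofReal t / ratioBound B q π ≤ score (gain p q π) t y := by
  rw [score, h.coe_gain]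
  refine ENNReal.div_le_div_left ?_ _
  exact le_iSup_of_le y.1 (le_iSup_of_le y.2 (le_iSup_of_le h.mem_region le_rfl))

lemma binCount_succ {ι : Type*} [DecidableEq ι] (js : ℕ → ι) (n : ℕ) :
    binCount js (n + 1) = Function.update (binCount js n) (js n) (binCount js n (js n) + 1) := by
  ext j
  rw [binCount, Finset.sum_range_succ, Function.update_apply]
  by_cases h : js n = j
  · subst h; simp [binCount]
  · simp [binCount, h, Ne.symm h]

/-- As long as it has not halted, the encoder holds a score above the minimum before the minimiser
arrives, and the minimum and its index afterwards. It cannot halt before that arrival, because a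
point arriving after the stopping criterion is met has a larger score than the best one so far. -/
lemma run_invariant (ω : Randomness 𝓩 J) (hgap : ∀ n, 0 < ω.1 n)
    (hreg : ∀ n, RegularMark B q π (markedPoints ω n).1) {n : ℕ}
    (hn : IsArgmin (gain p q π) (markedPoints ω) n)
    (hfin : pointScore (gain p q π) (markedPoints ω) n ≠ ∞) (m : ℕ) :
    ((run B q π ω m).halted → n < m ∧ (run B q π ω m).code = some (sampleIndex ω.2.1 n)) ∧
    (¬ (run B q π ω m).halted → (run B q π ω m).time = arrival (markedPoints ω) m ∧
      (run B q π ω m).count = binCount ω.2.1 m ∧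
      (m ≤ n → pointScore (gain p q π) (markedPoints ω) n < (run B q π ω m).bestScore) ∧
      (n < m → (run B q π ω m).bestScore = pointScore (gain p q π) (markedPoints ω) n ∧
        (run B q π ω m).code = some (sampleIndex ω.2.1 n))) := by
  set w := markedPoints ω with hw
  set g := gain p q π with hg
  have hmono : StrictMono (arrival w) := arrival_mono hgap
  induction m with
  | zero =>
    refine ⟨fun h => h.elim, fun _ => ⟨rfl, ?_, fun _ => ?_, fun h => absurd h (Nat.not_lt_zero n)⟩⟩
    · ext j; simp [run, State.init, binCount]
    · exact lt_top_iff_ne_top.2 hfin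
  | succ m ih =>
    by_cases hh : (run B q π ω m).halted
    · have hstep : run B q π ω (m + 1) = run B q π ω m := by rw [run, step, if_pos hh]
      rw [hstep]
      exact ⟨fun h => ⟨(ih.1 h).1.trans (Nat.lt_succ_self m), (ih.1 h).2⟩, fun h => absurd hh h⟩
    · obtain ⟨htime, hcount, hlt, heq⟩ := ih.2 hh
      set s := run B q π ω m with hs
      have hpos : 0 < arrival w (m + 1) := by
        rw [← arrival_zero w]; exact hmono (Nat.succ_pos m)
      have hτ : J * π (ω.2.1 m) * ENNReal.ofReal (s.time + ω.1 m) *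
          p (ω.2.2 (ω.2.1 m, s.count (ω.2.1 m) + 1)) / q (ω.2.2 (ω.2.1 m, s.count (ω.2.1 m) + 1)) =
          pointScore g w m := by
        rw [htime, hcount]
        have := (hreg m).score_eq hpos
        rw [arrival_succ] at this
        rw [pointScore, arrival_succ, this]
        rfl
      have hrun : run B q π ω (m + 1) =
          { time := arrival w (m + 1)
            count := binCount ω.2.1 (m + 1)
            bestScore := if pointScore g w m ≤ s.bestScore then pointScore g w m else s.bestScore
            code := if pointScore g w m ≤ s.bestScore then some (sampleIndex ω.2.1 m) else s.code
            halted := (if pointScore g w m ≤ s.bestScore then pointScore g w m else s.bestScore) <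
              ENNReal.ofReal (arrival w (m + 1)) / ratioBound B q π } := by
        rw [run, step, if_neg hh]
        simp only [← hs, hτ]
        have e1 : s.time + ω.1 m = arrival w (m + 1) := by rw [arrival_succ, htime]; rfl
        rw [e1, hcount, ← binCount_succ]
        rfl
      have hbest1 : m + 1 ≤ n → pointScore g w n <
          if pointScore g w m ≤ s.bestScore then pointScore g w m else s.bestScore := by
        intro hmn
        split_ifs
        · exact hn m (by omega)
        · exact hlt (by omega)
      have hbest2 : n < m + 1 →
          (if pointScore g w m ≤ s.bestScore then pointScore g w m else s.bestScore) =
            pointScore g w n ∧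
          (if pointScore g w m ≤ s.bestScore then some (sampleIndex ω.2.1 m) else s.code) =
            some (sampleIndex ω.2.1 n) := by
        intro hnm
        rcases Nat.lt_succ_iff_lt_or_eq.1 hnm with h | h
        · obtain ⟨h1, h2⟩ := heq h
          have : ¬ pointScore g w m ≤ s.bestScore := by
            rw [h1]; exact not_le.2 (hn m h.ne')
          rw [if_neg this, if_neg this]
          exact ⟨h1, h2⟩
        · subst h
          have := (hlt le_rfl).le
          rw [if_pos this, if_pos this]
          exact ⟨rfl, rfl⟩
      rw [hrun]
      refine ⟨fun hhalt => ?_, fun _ => ⟨rfl, rfl, hbest1, hbest2⟩⟩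
      -- Otherwise `τ_n` is below `arrival w (m + 1) / r'_max`, a lower bound of all later scores.
      have hnm : n < m + 1 := by
        by_contra hmn
        push Not at hmn
        have h1 : pointScore g w n < ENNReal.ofReal (arrival w (m + 1)) / ratioBound B q π :=
          (hbest1 hmn).trans hhalt
        have h2 : ENNReal.ofReal (arrival w (m + 1)) / ratioBound B q π ≤ pointScore g w n :=
          le_trans (ENNReal.div_le_div_right
            (ENNReal.ofReal_le_ofReal (hmono.monotone (by omega))) _)
            ((hreg n).div_ratioBound_le_score _)
        exact h1.not_ge h2
      exact ⟨hnm, (hbest2 hnm).2⟩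

/-- Whether or not it halts, the encoder outputs the index of the point of least score. -/
theorem output_run_eq (ω : Randomness 𝓩 J) (hgap : ∀ n, 0 < ω.1 n)
    (hreg : ∀ n, RegularMark B q π (markedPoints ω n).1) {n : ℕ}
    (hn : IsArgmin (gain p q π) (markedPoints ω) n)
    (hfin : pointScore (gain p q π) (markedPoints ω) n ≠ ∞) :
    output (run B q π ω) = some (sampleIndex ω.2.1 n) := by
  have hev : ∀ᶠ m in atTop, (run B q π ω m).code = some (sampleIndex ω.2.1 n) := by
    filter_upwards [eventually_gt_atTop n] with m hm
    obtain ⟨h1, h2⟩ := run_invariant ω hgap hreg hn hfin m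
    by_cases hh : (run B q π ω m).halted
    · exact (h1 hh).2
    · exact ((h2 hh).2.2.2 hm).2
  have h : ∃ c, ∀ᶠ m in atTop, (run B q π ω m).code = c := ⟨_, hev⟩
  rw [output, dif_pos h]
  obtain ⟨m, h1, h2⟩ := (h.choose_spec.and hev).exists
  rw [← h1, h2]

end Encoder

/-! ### The law of the marked points of a run -/

section Law
open scoped NNReal
variable {𝓩 : Type*} [MeasurableSpace 𝓩] {J : ℕ}

/-- Every iteration reads a fresh entry of the sample sequences. -/
lemma sampleIndex_injective {ι : Type*} (js : ℕ → ι) : Function.Injective (sampleIndex js) := by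
  classical
  have hlt : ∀ n m, n < m → sampleIndex js n ≠ sampleIndex js m := by
    intro n m h heq
    rw [sampleIndex, sampleIndex, Prod.mk.injEq] at heq
    obtain ⟨hj, hc⟩ := heq
    have h1 : binCount js (n + 1) (js n) = binCount js n (js n) + 1 := by
      rw [binCount_succ, Function.update_self]
    have h2 : binCount js (n + 1) (js n) ≤ binCount js m (js n) :=
      Finset.sum_le_sum_of_subset (Finset.range_mono h)
    rw [← hj] at hc
    omega
  intro n m h
  rcases lt_trichotomy n m with h' | h' | h'
  · exact absurd h (hlt n m h')
  · exact h'
  · exact absurd h.symm (hlt m n h')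

lemma measurable_sampleIndex (n : ℕ) : Measurable fun js : ℕ → Fin J => sampleIndex js n := by
  have h : Measurable fun js : ℕ → Fin J => binCount js n (js n) :=
    Finset.measurable_sum _ fun i _ => Measurable.ite
      (measurableSet_eq_fun (measurable_pi_apply i) (measurable_pi_apply n)) measurable_const
      measurable_const
  exact (measurable_pi_apply n).prodMk (h.add_const 1)

lemma measurable_eval_countable {ι : Type*} [MeasurableSpace ι] [Countable ι]
    [MeasurableSingletonClass ι] : Measurable fun p : (ι → 𝓩) × ι => p.1 p.2 :=
  measurable_from_prod_countable_left fun i => measurable_pi_apply i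

lemma measurable_sample :
    Measurable fun (p : (ℕ → Fin J) × (Fin J × ℕ → 𝓩)) (n : ℕ) => p.2 (sampleIndex p.1 n) :=
  measurable_pi_lambda _ fun n => measurable_eval_countable.comp
    (measurable_snd.prodMk ((measurable_sampleIndex n).comp measurable_fst))

@[fun_prop]
lemma measurable_markedPoints :
    Measurable (markedPoints : Randomness 𝓩 J → ℕ → (Fin J × 𝓩) × ℝ) := by
  refine measurable_pi_lambda _ fun n => Measurable.prodMk (Measurable.prodMk (by fun_prop) ?_)
    (by fun_prop)
  exact (measurable_pi_apply n).comp (measurable_sample.comp measurable_snd)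

variable {ν : Measure 𝓩} {p : 𝓩 → ℝ≥0∞} (B : BinSystem ν p J)

/-- The law `P|_{B_j}` of the samples of bin `j`, as a kernel. -/
def binKernel : Kernel (Fin J) 𝓩 := ⟨fun j => B.law j, measurable_of_countable _⟩

instance : IsMarkovKernel (binKernel B) :=
  ⟨fun j => inferInstanceAs (IsProbabilityMeasure (B.law j))⟩

/-- The law of the pair `(j_n, z_n)` when the bin index has law `α`. -/
abbrev markLaw (α : Measure (Fin J)) : Measure (Fin J × 𝓩) := α ⊗ₘ binKernel B

/-- The marked points of a run form a Poisson process on the half-line with i.i.d. marks. -/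
lemma map_markedPoints (α : Measure (Fin J)) [IsProbabilityMeasure α] :
    ((Measure.infinitePi fun _ : ℕ => expMeasure 1).prod ((Measure.infinitePi fun _ : ℕ => α).prod
      (Measure.infinitePi fun jk : Fin J × ℕ => B.law jk.1))).map markedPoints =
      poissonLaw (markLaw B α) := by
  have h1 := map_zip_eq_infinitePi α (binKernel B)
    (Measure.infinitePi fun jk : Fin J × ℕ => B.law jk.1) (fun js s n => s (sampleIndex js n))
    measurable_sample fun js => infinitePi_map_comp (fun jk : Fin J × ℕ => B.law jk.1) _
      (sampleIndex_injective js)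
  have h2 := map_zip_eq_infinitePi (markLaw B α) (Kernel.const _ (expMeasure 1))
    (Measure.infinitePi fun _ : ℕ => expMeasure 1) (fun _ Δ => Δ) measurable_snd fun a => by
      simp
  rw [Measure.compProd_const] at h2
  rw [poissonLaw, ← h2, ← h1]
  have hm1 : Measurable fun (p : (ℕ → Fin J) × (Fin J × ℕ → 𝓩)) i =>
      (p.1 i, p.2 (sampleIndex p.1 i)) :=
    measurable_pi_lambda _ fun i => Measurable.prodMk (by fun_prop)
      ((measurable_pi_apply i).comp measurable_sample)
  conv_rhs => rw [← Measure.map_id (μ := Measure.infinitePi fun _ : ℕ => expMeasure 1)]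
  rw [Measure.map_prod_map _ _ hm1 measurable_id, ← Measure.prod_swap,
    Measure.map_map (by fun_prop) measurable_swap,
    Measure.map_map (by fun_prop) (hm1.prodMap measurable_id)]
  rfl

variable {B} {q : 𝓩 → ℝ≥0∞} {α : Measure (Fin J)}

lemma lintegral_markLaw [SFinite α] (f : Fin J × 𝓩 → ℝ≥0∞) (hf : Measurable f) :
    ∫⁻ y, f y ∂(markLaw B α) = ∑ j, α {j} * (J * ∫⁻ z, B.density j z * f (j, z) ∂ν) := by
  rw [Measure.lintegral_compProd hf, lintegral_fintype]
  refine Finset.sum_congr rfl fun j _ => ?_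
  have : binKernel B j = B.law j := rfl
  have hfj : Measurable fun z => f (j, z) := hf.comp measurable_prodMk_left
  rw [this, BinSystem.law, lintegral_smul_measure,
    lintegral_withDensity_eq_lintegral_mul _ (B.measurable_density j) hfj, smul_eq_mul, mul_comm]
  rfl

lemma markLaw_bin [SFinite α] (j : Fin J) : markLaw B α {y | y.1 = j} = α {j} := by
  have h : (markLaw B α).fst = α := Measure.fst_compProd _ _
  conv_rhs => rw [← h, Measure.fst_apply (measurableSet_singleton j)]
  rfl

lemma measurable_gain (hp : Measurable p) (hq : Measurable q) (π : Fin J → ℝ≥0∞) :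
    Measurable (gain p q π) := by
  have : Measurable fun y : Fin J × 𝓩 => π y.1 := (measurable_of_countable π).comp measurable_fst
  unfold gain
  fun_prop

lemma ae_density_le : ∀ᵐ z ∂ν, ∀ j, B.density j z ≤ p z := by
  filter_upwards [B.sum_density] with z hz j
  rw [← hz]
  exact Finset.single_le_sum (f := fun j => B.density j z) (fun _ _ => zero_le) (Finset.mem_univ j)

lemma measurableSet_regularMark {β : Type*} [MeasurableSpace β] (hp : Measurable p)
    {q : β → 𝓩 → ℝ≥0∞} {π : β → Fin J → ℝ≥0∞} {y : β → Fin J × 𝓩}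
    (hπ : Measurable fun a => π a (y a).1) (hq : Measurable fun a => q a (y a).2)
    (hy : Measurable y) : MeasurableSet {a | RegularMark B (q a) (π a) (y a)} := by
  have hd : Measurable fun a => B.density (y a).1 (y a).2 :=
    (measurable_from_prod_countable_right fun j => B.measurable_density j :
      Measurable fun y : Fin J × 𝓩 => B.density y.1 y.2).comp hy
  have hpy : Measurable fun a => p (y a).2 := hp.comp (measurable_snd.comp hy)
  have h : {a | RegularMark B (q a) (π a) (y a)} =
      {a | π a (y a).1 ≠ 0} ∩ {a | π a (y a).1 ≠ ∞} ∩ {a | B.density (y a).1 (y a).2 ≠ 0} ∩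
        {a | p (y a).2 ≠ 0} ∩ {a | p (y a).2 ≠ ∞} ∩ {a | q a (y a).2 ≠ ∞} := by
    ext a
    constructor
    · rintro ⟨h1, h2, h3, h4, h5, h6⟩
      exact ⟨⟨⟨⟨⟨h1, h2⟩, h3⟩, h4⟩, h5⟩, h6⟩
    · rintro ⟨⟨⟨⟨⟨h1, h2⟩, h3⟩, h4⟩, h5⟩, h6⟩
      exact ⟨h1, h2, h3, h4, h5, h6⟩
  rw [h]
  have hne : ∀ {f : β → ℝ≥0∞} (c : ℝ≥0∞), Measurable f → MeasurableSet {a | f a ≠ c} :=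
    fun c hf => (hf (measurableSet_singleton c)).compl
  exact (((((hne 0 hπ).inter (hne ∞ hπ)).inter (hne 0 hd)).inter (hne 0 hpy)).inter
    (hne ∞ hpy)).inter (hne ∞ hq)

variable [IsProbabilityMeasure α] (hp : Measurable p) (hq : Measurable q) (hptop : ∀ᵐ z ∂ν, p z ≠ ∞)
  (hqtop : ∀ᵐ z ∂ν, q z ≠ ∞)
include hp hq hptop hqtop

lemma ae_regularMark : ∀ᵐ y ∂(markLaw B α), RegularMark B q (fun j => α {j}) y := by
  have hset : MeasurableSet {y : Fin J × 𝓩 | RegularMark B q (fun j => α {j}) y} :=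
    measurableSet_regularMark hp (π := fun _ j => α {j}) (q := fun _ => q) (y := id)
      ((measurable_of_countable fun j => α {j}).comp measurable_fst) (hq.comp measurable_snd)
      measurable_id
  rw [Measure.ae_compProd_iff hset, ae_iff_of_countable]
  intro j hj
  have : binKernel B j = B.law j := rfl
  rw [this, BinSystem.law]
  refine Measure.ae_smul_measure ?_ _
  rw [ae_withDensity_iff (B.measurable_density j)]
  filter_upwards [hptop, hqtop, ae_density_le (B := B)] with z h1 h2 h3 h4
  exact ⟨hj, measure_ne_top _ _, h4, fun h0 => h4 (le_antisymm (h0 ▸ h3 j) zero_le), h1, h2⟩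

/-- Weighting the proposal `markLaw B α` by the gain gives the target law for the sample. -/
lemma lintegral_mul_gain (hac : ∀ᵐ z ∂ν, p z = 0 → q z = 0)
    (hsupp : ∀ j, ν.withDensity q (B.region j) ≠ 0 → α {j} ≠ 0) (F : 𝓩 → ℝ≥0∞)
    (hF : Measurable F) :
    ∫⁻ y, F y.2 * gain p q (fun j => α {j}) y ∂(markLaw B α) = ∫⁻ z, F z ∂(ν.withDensity q) := by
  have hα : Measurable fun y : Fin J × 𝓩 => α {y.1} :=
    (measurable_of_countable fun j => α {j}).comp measurable_fst
  have h1 : ∫⁻ y, F y.2 * gain p q (fun j => α {j}) y ∂(markLaw B α) =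
      ∫⁻ y, F y.2 * (q y.2 / p y.2 * ((J : ℝ≥0∞)⁻¹ / α {y.1})) ∂(markLaw B α) := by
    refine lintegral_congr_ae ?_
    filter_upwards [ae_regularMark (B := B) (α := α) hp hq hptop hqtop] with y hy
    rw [hy.coe_gain]
  rw [h1, lintegral_markLaw _ (by fun_prop)]
  have h2 : ∀ j, α {j} *
      (J * ∫⁻ z, B.density j z * (F z * (q z / p z * ((J : ℝ≥0∞)⁻¹ / α {j}))) ∂ν) =
      ∫⁻ z, B.density j z * (F z * (q z / p z)) ∂ν := by
    intro j
    have hJ : (J : ℝ≥0∞) ≠ 0 := by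
      have := j.pos
      exact_mod_cast this.ne'
    have hd := B.measurable_density j
    -- A bin of weight zero is never proposed, but then the target does not charge it either.
    by_cases hj : α {j} = 0
    · have hz : ν.withDensity q (B.region j) = 0 := by
        by_contra h
        exact hsupp j h hj
      have hreg : MeasurableSet (B.region j) := (hd (measurableSet_singleton 0)).compl
      rw [withDensity_apply _ hreg, ← lintegral_indicator hreg,
        lintegral_eq_zero_iff (hq.indicator hreg)] at hz
      rw [hj, zero_mul, eq_comm, lintegral_eq_zero_iff (by fun_prop)]
      filter_upwards [hz] with z hz
      by_cases hdz : B.density j z = 0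
      · simp [hdz]
      · have : q z = 0 := by
          have hmem : z ∈ B.region j := hdz
          simpa [hmem] using hz
        simp [this]
    · have h3 : ∀ z, B.density j z * (F z * (q z / p z * ((J : ℝ≥0∞)⁻¹ / α {j}))) =
          ((J : ℝ≥0∞)⁻¹ / α {j}) * (B.density j z * (F z * (q z / p z))) := fun z => by ring
      simp_rw [h3]
      rw [lintegral_const_mul _ (by fun_prop), ← mul_assoc, ← mul_assoc]
      have h4 : α {j} * J * ((J : ℝ≥0∞)⁻¹ / α {j}) = 1 := by
        rw [mul_assoc, ← mul_div_assoc,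
          ENNReal.mul_inv_cancel hJ (ENNReal.natCast_ne_top J), one_div,
          ENNReal.mul_inv_cancel hj (measure_ne_top _ _)]
      rw [h4, one_mul]
  simp_rw [h2]
  rw [← lintegral_finsetSum _ fun j _ => by
    have := B.measurable_density j
    fun_prop, lintegral_withDensity_eq_lintegral_mul _ hq hF]
  refine lintegral_congr_ae ?_
  filter_upwards [B.sum_density, hac, hptop] with z hz h0 htop
  rw [← Finset.sum_mul, hz, Pi.mul_apply]
  by_cases hpz : p z = 0
  · simp [hpz, h0 hpz]
  · calc p z * (F z * (q z / p z)) = F z * (p z * (q z / p z)) := by ring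
      _ = q z * F z := by rw [ENNReal.mul_div_cancel hpz htop, mul_comm]

lemma lintegral_gain [hQ : IsProbabilityMeasure (ν.withDensity q)]
    (hac : ∀ᵐ z ∂ν, p z = 0 → q z = 0)
    (hsupp : ∀ j, ν.withDensity q (B.region j) ≠ 0 → α {j} ≠ 0) :
    ∫⁻ y, gain p q (fun j => α {j}) y ∂(markLaw B α) = 1 := by
  have h := lintegral_mul_gain (B := B) (α := α) hp hq hptop hqtop hac hsupp (fun _ => 1)
    measurable_const
  simpa using h

/-- The conditional expected logarithm of the index `ñ*` of the selected sample in its bin. -/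
lemma tsum_lintegral_log_binCount_le [hQ : IsProbabilityMeasure (ν.withDensity q)]
    (hac : ∀ᵐ z ∂ν, p z = 0 → q z = 0)
    (hsupp : ∀ j, ν.withDensity q (B.region j) ≠ 0 → α {j} ≠ 0) :
    ∑' n, ∫⁻ w, (open scoped Classical in
        if IsArgmin (gain p q fun j => α {j}) w n then
        ENNReal.ofReal (Real.log ((earlierInBin Prod.fst w n : ℝ) + 1)) else 0)
        ∂(poissonLaw (markLaw B α)) ≤
      ∫⁻ z, ENNReal.ofReal (Real.log (1 + (q z / p z).toReal / J)) ∂(ν.withDensity q) := by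
  have hg := measurable_gain (J := J) hp hq fun j => α {j}
  refine (tsum_lintegral_log_earlierInBin_le hg
    (lintegral_gain (B := B) hp hq hptop hqtop hac hsupp) measurable_fst).trans ?_
  rw [← lintegral_mul_gain (B := B) (α := α) hp hq hptop hqtop hac hsupp _ (by fun_prop)]
  refine lintegral_mono_ae ?_
  filter_upwards [ae_regularMark (B := B) (α := α) hp hq hptop hqtop] with y hy
  refine le_of_eq ?_
  congr 4
  rw [measureReal_def, markLaw_bin, ← ENNReal.coe_toReal (gain p q _ y), hy.coe_gain,
    ENNReal.toReal_mul, ENNReal.toReal_div _ (α {y.1}), ENNReal.toReal_inv, ENNReal.toReal_natCast]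
  have : (α {y.1}).toReal ≠ 0 := (ENNReal.toReal_pos hy.weight_ne_zero hy.weight_ne_top).ne'
  field_simp

/-- Almost surely, the marked points are regular and there is a unique one of least score. -/
lemma ae_regular_and_exists_isArgmin [hQ : IsProbabilityMeasure (ν.withDensity q)]
    (hac : ∀ᵐ z ∂ν, p z = 0 → q z = 0)
    (hsupp : ∀ j, ν.withDensity q (B.region j) ≠ 0 → α {j} ≠ 0) :
    ∀ᵐ w ∂(poissonLaw (markLaw B α)), (∀ n, 0 < (w n).2) ∧
      (∀ n, RegularMark B q (fun j => α {j}) (w n).1) ∧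
      ∃ n, IsArgmin (gain p q fun j => α {j}) w n ∧
        pointScore (gain p q fun j => α {j}) w n ≠ ∞ := by
  have hreg : ∀ᵐ w ∂(poissonLaw (markLaw B α)), ∀ n,
      RegularMark B q (fun j => α {j}) (w n).1 := by
    refine ae_all_iff.2 fun n => ?_
    have h1 : ∀ᵐ y ∂((markLaw B α).prod (expMeasure 1)), RegularMark B q (fun j => α {j}) y.1 :=
      Measure.quasiMeasurePreserving_fst.ae (ae_regularMark hp hq hptop hqtop)
    exact (measurePreserving_eval_infinitePi
      (fun _ : ℕ => (markLaw B α).prod (expMeasure 1)) n).quasiMeasurePreserving.ae h1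
  filter_upwards [ae_gap_pos, hreg, ae_exists_isArgmin (measurable_gain hp hq _)
    (lintegral_gain (B := B) (α := α) hp hq hptop hqtop hac hsupp)] with w h1 h2 h3
  exact ⟨h1, h2, h3⟩

end Law

/-! ### Entropy and code length -/

section Entropy

lemma negMulLog_add_le {a θ : ℝ} (ha : 0 ≤ a) (hθ : 0 < θ) :
    Real.negMulLog a + a ≤ a * -Real.log θ + θ := by
  rcases ha.eq_or_lt with rfl | ha
  · simpa using hθ.le
  · have h := Real.log_le_sub_one_of_pos (div_pos hθ ha)
    rw [Real.log_div hθ.ne' ha.ne'] at h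
    have h2 := mul_le_mul_of_nonneg_left h ha.le
    have h3 : a * (θ / a - 1) = θ - a := by field_simp
    rw [Real.negMulLog]
    linarith

lemma measurable_comp_of_countable {Ω α : Type*} [MeasurableSpace Ω] [Countable α] {C : Ω → α}
    (hC : ∀ c, MeasurableSet {ω | C ω = c}) (f : α → ℝ≥0∞) : Measurable fun ω => f (C ω) := by
  let _ : MeasurableSpace α := ⊤
  have hC' : Measurable C := measurable_to_countable' hC
  exact measurable_from_top.comp hC'

/-- Gibbs' inequality: the entropy is at most the expected length of a code with ideal code lengths
`-log θ`. -/
lemma tsum_negMulLog_le {Ω α : Type*} [MeasurableSpace Ω] [Countable α] (μ : Measure Ω)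
    [IsProbabilityMeasure μ] {C : Ω → α} (hC : ∀ c, MeasurableSet {ω | C ω = c}) (θ : α → ℝ)
    (hθ : ∀ c, μ {ω | C ω = c} ≠ 0 → 0 < θ c)
    (hsum : ∑' c, ENNReal.ofReal (θ c) ≤ 1) :
    ∑' c, ENNReal.ofReal (Real.negMulLog (μ.real {ω | C ω = c})) ≤
      ∫⁻ ω, ENNReal.ofReal (-Real.log (θ (C ω))) ∂μ := by
  let _ : MeasurableSpace α := ⊤
  have hC : Measurable C := measurable_to_countable' hC
  have hmap : ∀ c, μ.map C {c} = μ {ω | C ω = c} := fun c =>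
    Measure.map_apply hC (measurableSet_singleton c)
  have hm : ∀ f : α → ℝ≥0∞, Measurable f := fun f => measurable_from_top
  have hint : ∫⁻ ω, ENNReal.ofReal (-Real.log (θ (C ω))) ∂μ =
      ∑' c, μ {ω | C ω = c} * ENNReal.ofReal (-Real.log (θ c)) := by
    rw [← lintegral_map (f := fun c => ENNReal.ofReal (-Real.log (θ c))) (hm _) hC,
      lintegral_countable']
    simp_rw [hmap, mul_comm]
  have hone : ∑' c, μ {ω | C ω = c} = 1 := by
    have h1 : ∫⁻ _ : α, 1 ∂(μ.map C) = 1 := by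
      rw [lintegral_one, Measure.map_apply hC MeasurableSet.univ]; simp
    rw [lintegral_countable'] at h1
    simpa [hmap] using h1
  rw [← ENNReal.add_le_add_iff_right (a := 1) ENNReal.one_ne_top, hint]
  calc _ = ∑' c, (ENNReal.ofReal (Real.negMulLog (μ.real {ω | C ω = c})) + μ {ω | C ω = c}) := by
        rw [ENNReal.tsum_add, hone]
    _ ≤ ∑' c, (μ {ω | C ω = c} * ENNReal.ofReal (-Real.log (θ c)) + ENNReal.ofReal (θ c)) := by
        refine ENNReal.tsum_le_tsum fun c => ?_
        by_cases h0 : μ {ω | C ω = c} = 0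
        · simp [measureReal_def, h0]
        · have hpos := hθ c h0
          have h01 : 0 ≤ μ.real {ω | C ω = c} := measureReal_nonneg
          have h11 : μ.real {ω | C ω = c} ≤ 1 := measureReal_le_one
          rw [← ofReal_measureReal (μ := μ) (s := {ω | C ω = c}),
            ← ENNReal.ofReal_add (Real.negMulLog_nonneg h01 h11) h01]
          refine (ENNReal.ofReal_le_ofReal (negMulLog_add_le h01 hpos)).trans ?_
          refine ENNReal.ofReal_add_le.trans ?_
          rw [ENNReal.ofReal_mul h01]
    _ ≤ _ := by
        rw [ENNReal.tsum_add]
        gcongr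

lemma rpow_neg_le_sub {δ : ℝ} (hδ : 0 < δ) {x : ℝ} (hx : 0 < x) :
    (x + 1) ^ (-(1 + δ)) ≤ δ⁻¹ * (x ^ (-δ) - (x + 1) ^ (-δ)) := by
  have hx1 : 0 < x + 1 := by linarith
  have h1 : (x + 1) ^ (-(1 + δ)) = (x + 1) ^ (-δ) * (x + 1)⁻¹ := by
    rw [show -(1 + δ) = -δ + -1 by ring, Real.rpow_add hx1, Real.rpow_neg_one]
  have hlog : (x + 1)⁻¹ ≤ Real.log ((x + 1) / x) := by
    have h := Real.log_le_sub_one_of_pos (div_pos hx hx1)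
    have h2 : Real.log (x / (x + 1)) = -Real.log ((x + 1) / x) := by
      rw [← Real.log_inv, inv_div]
    have h3 : x / (x + 1) - 1 = -(x + 1)⁻¹ := by field_simp; ring
    linarith
  have h2 : x ^ (-δ) = (x + 1) ^ (-δ) * Real.exp (δ * Real.log ((x + 1) / x)) := by
    rw [Real.rpow_def_of_pos hx, Real.rpow_def_of_pos hx1, ← Real.exp_add,
      Real.log_div hx1.ne' hx.ne']
    congr 1; ring
  have h3 : 1 + δ * (x + 1)⁻¹ ≤ Real.exp (δ * Real.log ((x + 1) / x)) := by
    have := Real.add_one_le_exp (δ * Real.log ((x + 1) / x))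
    have := mul_le_mul_of_nonneg_left hlog hδ.le
    linarith
  have h4 := mul_le_mul_of_nonneg_left h3 (Real.rpow_nonneg hx1.le (-δ))
  rw [h1, ← mul_le_mul_iff_of_pos_left hδ, ← mul_assoc δ δ⁻¹, mul_inv_cancel₀ hδ.ne', one_mul, h2]
  nlinarith

/-- `∑_{k ≥ 1} k ^ (-(1 + δ)) ≤ 1 + 1 / δ`, by comparison with the integral. -/
lemma tsum_rpow_neg_le {δ : ℝ} (hδ : 0 < δ) :
    ∑' k : ℕ, ENNReal.ofReal (((k : ℝ) + 1) ^ (-(1 + δ))) ≤ ENNReal.ofReal (1 + δ⁻¹) := by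
  have hpart : ∀ n : ℕ, ∑ k ∈ Finset.range (n + 1), ((k : ℝ) + 1) ^ (-(1 + δ)) ≤
      1 + δ⁻¹ * (1 - ((n : ℝ) + 1) ^ (-δ)) := by
    intro n
    induction n with
    | zero => simp
    | succ n ih =>
      rw [Finset.sum_range_succ]
      have := rpow_neg_le_sub hδ (x := (n : ℝ) + 1) (by positivity)
      push_cast
      linarith
  rw [ENNReal.tsum_eq_iSup_nat]
  refine iSup_le fun n => ?_
  refine le_trans (Finset.sum_le_sum_of_subset (Finset.range_mono (Nat.le_succ n))) ?_
  rw [← ENNReal.ofReal_sum_of_nonneg fun k _ => by positivity]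
  refine ENNReal.ofReal_le_ofReal ((hpart n).trans ?_)
  have : 0 ≤ δ⁻¹ * ((n : ℝ) + 1) ^ (-δ) := by positivity
  linarith

/-- The probability `k ^ (-(1 + 1 / A)) / (J (1 + A))` assigned to the code word `(j, k)`. The words
`none` and `(j, 0)`, which are almost surely not used, get probability zero. -/
def codeProb (J : ℕ) (A : ℝ) : Option (Fin J × ℕ) → ℝ
  | some (_, k + 1) => ((k : ℝ) + 1) ^ (-(1 + A⁻¹)) / (J * (1 + A))
  | _ => 0

lemma tsum_codeProb_le (J : ℕ) {A : ℝ} (hA : 0 < A) :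
    ∑' c, ENNReal.ofReal (codeProb J A c) ≤ 1 := by
  rcases Nat.eq_zero_or_pos J with rfl | hJ
  · have : ∀ c, codeProb 0 A c = 0 := by
      rintro (_ | ⟨j, _⟩)
      · rfl
      · exact j.elim0
    simp [this]
  have hJ' : (0 : ℝ) < J := by exact_mod_cast hJ
  have h1 : ∑' c, ENNReal.ofReal (codeProb J A c) =
      ∑' c : Fin J × ℕ, ENNReal.ofReal (codeProb J A (some c)) := by
    refine (Function.Injective.tsum_eq (Option.some_injective _) ?_).symm
    rintro (_ | c) hc
    · simp [codeProb] at hc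
    · exact ⟨c, rfl⟩
  have h2 : ∀ j : Fin J, ∑' k, ENNReal.ofReal (codeProb J A (some (j, k))) ≤ (J : ℝ≥0∞)⁻¹ := by
    intro j
    rw [tsum_eq_zero_add' ENNReal.summable]
    have h3 : ∀ k : ℕ, ENNReal.ofReal (codeProb J A (some (j, k + 1))) =
        ENNReal.ofReal (((k : ℝ) + 1) ^ (-(1 + A⁻¹))) * ENNReal.ofReal (J * (1 + A))⁻¹ := by
      intro k
      rw [codeProb, div_eq_mul_inv, ENNReal.ofReal_mul (by positivity)]
    simp_rw [h3]
    rw [ENNReal.tsum_mul_right, codeProb, ENNReal.ofReal_zero, zero_add]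
    · refine (mul_le_mul_left (tsum_rpow_neg_le (inv_pos.2 hA)) _).trans ?_
      rw [inv_inv, ← ENNReal.ofReal_mul (by positivity), mul_inv, mul_comm, mul_assoc,
        inv_mul_cancel₀ (by positivity), mul_one, ENNReal.ofReal_inv_of_pos hJ',
        ENNReal.ofReal_natCast]
    · intro _ _ h
      simp at h
  rw [h1, ENNReal.tsum_prod', tsum_fintype]
  calc _ ≤ ∑ _ : Fin J, (J : ℝ≥0∞)⁻¹ := Finset.sum_le_sum fun j _ => h2 j
    _ = 1 := by
      rw [Finset.sum_const, Finset.card_univ, Fintype.card_fin, nsmul_eq_mul,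
        ENNReal.mul_inv_cancel (by exact_mod_cast hJ.ne') (ENNReal.natCast_ne_top J)]

/-- The logarithm of the second part of a code word. -/
def logIndex {J : ℕ} : Option (Fin J × ℕ) → ℝ≥0∞
  | some (_, k) => ENNReal.ofReal (Real.log k)
  | none => 0

lemma neg_log_codeProb {J : ℕ} {A : ℝ} (hA : 0 < A) (j : Fin J) (k : ℕ) :
    ENNReal.ofReal (-Real.log (codeProb J A (some (j, k + 1)))) =
      ENNReal.ofReal (Real.log J + Real.log (1 + A)) +
        ENNReal.ofReal (1 + A⁻¹) * logIndex (some (j, k + 1)) := by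
  have hJ : (1 : ℝ) ≤ J := by exact_mod_cast j.pos
  have hk : (0 : ℝ) < (k : ℝ) + 1 := by positivity
  have hlk : 0 ≤ Real.log ((k : ℝ) + 1) :=
    Real.log_nonneg (by linarith [(Nat.cast_nonneg k : (0 : ℝ) ≤ k)])
  have hl : 0 ≤ Real.log J + Real.log (1 + A) :=
    add_nonneg (Real.log_nonneg hJ) (Real.log_nonneg (by linarith))
  rw [logIndex, ← ENNReal.ofReal_mul (by positivity), Nat.cast_add, Nat.cast_one,
    ← ENNReal.ofReal_add hl (by positivity), codeProb,
    Real.log_div (by positivity) (by positivity), Real.log_rpow hk,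
    Real.log_mul (by positivity) (by positivity)]
  congr 1; ring

/-- If the second part of the code has mean logarithm at most `A` bits, its entropy is at most
`log₂ J + A + log₂ (1 + A) + 1` bits. -/
lemma entropyBits_le {Ω : Type*} [MeasurableSpace Ω] (μ : Measure Ω) [IsProbabilityMeasure μ]
    {J : ℕ} {C : Ω → Option (Fin J × ℕ)} (hC : ∀ c, MeasurableSet {ω | C ω = c})
    (hpos : ∀ᵐ ω ∂μ, ∃ j k, C ω = some (j, k + 1)) {A : ℝ} (hA : 0 < A)
    (hlog : ∫⁻ ω, logIndex (C ω) ∂μ ≤ ENNReal.ofReal (A * Real.log 2)) :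
    entropyBits μ C ≤
      ENNReal.ofReal (Real.logb 2 J + A + Real.logb 2 (1 + A) + 1) := by
  have hl2 : 0 < Real.log 2 := Real.log_pos one_lt_two
  obtain ⟨ω₀, j₀, k₀, -⟩ := hpos.exists
  have hJ : (1 : ℝ) ≤ J := by exact_mod_cast j₀.pos
  have hl : 0 ≤ Real.log J + Real.log (1 + A) :=
    add_nonneg (Real.log_nonneg hJ) (Real.log_nonneg (by linarith))
  have hθ : ∀ c, μ {ω | C ω = c} ≠ 0 → 0 < codeProb J A c := by
    intro c hc
    obtain ⟨ω, hω, j, k, hjk⟩ := (frequently_ae_iff.2 hc).and_eventually hpos |>.exists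
    have : c = some (j, k + 1) := hω.symm.trans hjk
    rw [this, codeProb]
    · positivity
  have h1 := tsum_negMulLog_le μ hC (codeProb J A) hθ (tsum_codeProb_le J hA)
  have hlm : Measurable fun ω => logIndex (C ω) := measurable_comp_of_countable hC _
  have h2 : ∫⁻ ω, ENNReal.ofReal (-Real.log (codeProb J A (C ω))) ∂μ ≤
      ENNReal.ofReal (Real.log J + Real.log (1 + A)) +
        ENNReal.ofReal (1 + A⁻¹) * ENNReal.ofReal (A * Real.log 2) := by
    calc _ = ∫⁻ ω, (ENNReal.ofReal (Real.log J + Real.log (1 + A)) +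
          ENNReal.ofReal (1 + A⁻¹) * logIndex (C ω)) ∂μ := by
          refine lintegral_congr_ae ?_
          filter_upwards [hpos] with ω hω
          obtain ⟨j, k, h⟩ := hω
          rw [h, neg_log_codeProb hA]
      _ = ENNReal.ofReal (Real.log J + Real.log (1 + A)) +
          ENNReal.ofReal (1 + A⁻¹) * ∫⁻ ω, logIndex (C ω) ∂μ := by
          rw [lintegral_add_left measurable_const, lintegral_const_mul _ hlm, lintegral_const,
            measure_univ, mul_one]
      _ ≤ _ := by gcongr
  have h3 : entropyBits μ C = (∑' c, ENNReal.ofReal (Real.negMulLog (μ.real {ω | C ω = c}))) *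
      ENNReal.ofReal (Real.log 2)⁻¹ := by
    rw [entropyBits, ← ENNReal.tsum_mul_right]
    refine tsum_congr fun c => ?_
    rw [div_eq_mul_inv, ENNReal.ofReal_mul' (by positivity)]
  rw [h3]
  refine (mul_le_mul_left (h1.trans h2) _).trans ?_
  rw [← ENNReal.ofReal_mul (by positivity), ← ENNReal.ofReal_add hl (by positivity),
    ← ENNReal.ofReal_mul (by positivity)]
  refine ENNReal.ofReal_le_ofReal (le_of_eq ?_)
  rw [Real.logb, Real.logb]
  field_simp
  ring

end Entropy

/-! ### Mutual information in terms of densities -/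

section Information
variable {𝓧 𝓩 : Type*} [MeasurableSpace 𝓧] [MeasurableSpace 𝓩] {ρ : Measure (𝓧 × 𝓩)}
  [IsProbabilityMeasure ρ] {Q : Kernel 𝓧 𝓩} [IsMarkovKernel Q] {ν : Measure 𝓩}
  {p : 𝓩 → ℝ≥0∞} {q : 𝓧 → 𝓩 → ℝ≥0∞}

lemma ae_ne_top_of_withDensity {f : 𝓩 → ℝ≥0∞} (hf : Measurable f)
    (h : IsFiniteMeasure (ν.withDensity f)) : ∀ᵐ z ∂ν, f z ≠ ∞ := by
  have h1 : ∫⁻ z, f z ∂ν ≠ ∞ := by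
    rw [← setLIntegral_univ, ← withDensity_apply _ MeasurableSet.univ]
    exact measure_ne_top _ _
  filter_upwards [ae_lt_top hf h1] with z hz using hz.ne

/-- The target density vanishes where the marginal density does. -/
lemma ae_ae_density_eq_zero (hQ : ρ.fst ⊗ₘ Q = ρ) (hp : Measurable p)
    (hpP : ρ.snd = ν.withDensity p) (hq : Measurable (Function.uncurry q))
    (hqQ : ∀ᵐ x ∂ρ.fst, Q x = ν.withDensity (q x)) :
    ∀ᵐ x ∂ρ.fst, ∀ᵐ z ∂ν, p z = 0 → q x z = 0 := by
  have hset : MeasurableSet {z | p z = 0} := hp (measurableSet_singleton 0)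
  have h1 : ρ.snd {z | p z = 0} = 0 := by
    rw [hpP, withDensity_apply _ hset, setLIntegral_congr_fun hset (g := fun _ => 0) fun z hz => hz]
    simp
  have h2 : ∫⁻ x, Q x {z | p z = 0} ∂ρ.fst = ρ.snd {z | p z = 0} := by
    rw [Measure.snd_apply hset]
    conv_rhs => rw [← hQ, Measure.compProd_apply (measurable_snd hset)]
    rfl
  rw [h1] at h2
  rw [lintegral_eq_zero_iff (Kernel.measurable_coe Q hset)] at h2
  filter_upwards [h2, hqQ] with x hx hqx
  have hqm : Measurable (q x) := hq.comp measurable_prodMk_left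
  rw [hqx, Pi.zero_apply, withDensity_apply _ hset, ← lintegral_indicator hset,
    lintegral_eq_zero_iff (hqm.indicator hset)] at hx
  filter_upwards [hx] with z hz hpz
  simpa [hpz] using hz

/-- The ratio `q / p` is the density of the joint law with respect to the product of its
marginals. -/
lemma eq_withDensity_ratio (hQ : ρ.fst ⊗ₘ Q = ρ) (hp : Measurable p)
    (hpP : ρ.snd = ν.withDensity p) (hq : Measurable (Function.uncurry q))
    (hqQ : ∀ᵐ x ∂ρ.fst, Q x = ν.withDensity (q x)) :
    ρ = (ρ.fst.prod ρ.snd).withDensity fun y => q y.1 y.2 / p y.2 := by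
  have hR : Measurable fun y : 𝓧 × 𝓩 => q y.1 y.2 / p y.2 := by
    exact hq.div (hp.comp measurable_snd)
  have hptop := ae_ne_top_of_withDensity (ν := ν) hp (hpP ▸ inferInstance)
  refine Measure.ext fun s hs => ?_
  rw [withDensity_apply _ hs, ← lintegral_indicator hs,
    lintegral_prod _ (hR.indicator hs).aemeasurable]
  conv_lhs => rw [← hQ, Measure.compProd_apply hs]
  refine lintegral_congr_ae ?_
  filter_upwards [hqQ, ae_ae_density_eq_zero hQ hp hpP hq hqQ] with x hqx h0
  have hsx : MeasurableSet (Prod.mk x ⁻¹' s) := measurable_prodMk_left hs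
  have hqm : Measurable (q x) := hq.comp measurable_prodMk_left
  have hRx : Measurable fun z => s.indicator (fun y : 𝓧 × 𝓩 => q y.1 y.2 / p y.2) (x, z) :=
    (hR.indicator hs).comp measurable_prodMk_left
  rw [hpP, lintegral_withDensity_eq_lintegral_mul _ hp hRx, hqx, withDensity_apply _ hsx,
    ← lintegral_indicator hsx]
  refine lintegral_congr_ae ?_
  filter_upwards [h0, hptop] with z hz htop
  by_cases hzs : (x, z) ∈ s
  · have hzs' : z ∈ Prod.mk x ⁻¹' s := hzs
    rw [Pi.mul_apply, Set.indicator_of_mem hzs, Set.indicator_of_mem hzs']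
    by_cases hpz : p z = 0
    · simp [hpz, hz hpz]
    · rw [ENNReal.mul_div_cancel hpz htop]
  · have hzs' : z ∉ Prod.mk x ⁻¹' s := hzs
    rw [Pi.mul_apply, Set.indicator_of_notMem hzs, Set.indicator_of_notMem hzs', mul_zero]

lemma lintegral_eq_of_compProd (hQ : ρ.fst ⊗ₘ Q = ρ) {f : 𝓧 × 𝓩 → ℝ≥0∞} (hf : Measurable f) :
    ∫⁻ x, ∫⁻ z, f (x, z) ∂(Q x) ∂ρ.fst = ∫⁻ y, f y ∂ρ := by
  conv_rhs => rw [← hQ, Measure.lintegral_compProd hf]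

lemma log_one_add_le {J : ℕ} (hJ : 0 < J) {r : ℝ} (hr : 0 < r) :
    Real.log (1 + r / J) ≤ (Real.logb 2 r - Real.logb 2 J +
      max 0 (Real.logb 2 J - Real.logb 2 r) + 1) * Real.log 2 := by
  have hl2 : 0 < Real.log 2 := Real.log_pos one_lt_two
  have hJ' : (0 : ℝ) < J := by exact_mod_cast hJ
  have hb : ∀ x, Real.logb 2 x * Real.log 2 = Real.log x := fun x => by
    rw [Real.logb]; field_simp
  have hmax : max 0 (Real.logb 2 J - Real.logb 2 r) * Real.log 2 =
      max 0 (Real.log J - Real.log r) := by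
    rw [max_mul_of_nonneg _ _ hl2.le, zero_mul, sub_mul, hb, hb]
  rw [add_mul, add_mul, sub_mul, hb, hb, hmax, one_mul]
  have hx : 0 < r / J := by positivity
  rcases le_total 1 (r / J) with h | h
  · have h1 : Real.log (1 + r / J) ≤ Real.log (2 * (r / J)) :=
      Real.log_le_log (by positivity) (by linarith)
    rw [Real.log_mul two_ne_zero hx.ne', Real.log_div hr.ne' hJ'.ne'] at h1
    linarith [le_max_left 0 (Real.log J - Real.log r)]
  · have h1 : Real.log (1 + r / J) ≤ Real.log 2 := Real.log_le_log (by positivity) (by linarith)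
    linarith [le_max_right 0 (Real.log J - Real.log r)]

/-- The expected logarithm of `1 + q / (J p)` is at most `I - log₂ J + E[ε] + 1` bits, and this
bound is at least one bit. -/
lemma lintegral_log_ratio_le (hQ : ρ.fst ⊗ₘ Q = ρ) (hp : Measurable p)
    (hpP : ρ.snd = ν.withDensity p) (hq : Measurable (Function.uncurry q))
    (hqQ : ∀ᵐ x ∂ρ.fst, Q x = ν.withDensity (q x)) {J : ℕ} (hJ : 0 < J)
    (hI : mutualInfoBits ρ ≠ ∞) (hE : ∫⁻ x, epsilonCost J (Q x) p (q x) ∂ρ.fst ≠ ∞) :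
    1 ≤ (mutualInfoBits ρ).toReal - Real.logb 2 J +
        (∫⁻ x, epsilonCost J (Q x) p (q x) ∂ρ.fst).toReal + 1 ∧
    ∫⁻ x, ∫⁻ z, ENNReal.ofReal (Real.log (1 + (q x z / p z).toReal / J)) ∂(Q x) ∂ρ.fst ≤
      ENNReal.ofReal (((mutualInfoBits ρ).toReal - Real.logb 2 J +
        (∫⁻ x, epsilonCost J (Q x) p (q x) ∂ρ.fst).toReal + 1) * Real.log 2) := by
  have hl2 : 0 < Real.log 2 := Real.log_pos one_lt_two
  set R : 𝓧 × 𝓩 → ℝ≥0∞ := fun y => q y.1 y.2 / p y.2 with hRdef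
  have hR : Measurable R := hq.div (hp.comp measurable_snd)
  have hρ : ρ = (ρ.fst.prod ρ.snd).withDensity R := eq_withDensity_ratio hQ hp hpP hq hqQ
  have hac : ρ ≪ ρ.fst.prod ρ.snd :=
    (Measure.absolutelyContinuous_of_le hρ.le).trans (withDensity_absolutelyContinuous _ R)
  have hRtop : ∀ᵐ y ∂ρ, R y ≠ ∞ :=
    hac.ae_le (ae_ne_top_of_withDensity hR (hρ ▸ inferInstance))
  have hR0 : ∀ᵐ y ∂ρ, R y ≠ 0 := by
    rw [hρ, ae_withDensity_iff hR]
    exact Eventually.of_forall fun _ h => h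
  have hrn : ρ.rnDeriv (ρ.fst.prod ρ.snd) =ᵐ[ρ] R := by
    have h := Measure.rnDeriv_withDensity (ρ.fst.prod ρ.snd) hR
    rw [← hρ] at h
    exact hac.ae_le h
  have hllr : llr ρ (ρ.fst.prod ρ.snd) =ᵐ[ρ] fun y => Real.log (R y).toReal := by
    filter_upwards [hrn] with y hy
    rw [llr, hy]
  have hkl : InformationTheory.klDiv ρ (ρ.fst.prod ρ.snd) ≠ ∞ := by
    intro h
    apply hI
    rw [mutualInfoBits, h, ENNReal.top_div_of_ne_top ENNReal.ofReal_ne_top]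
  have hint := (InformationTheory.klDiv_ne_top_iff.1 hkl).2
  have hlogint : Integrable (fun y => Real.logb 2 (R y).toReal) ρ :=
    ((integrable_congr hllr).1 hint).div_const _
  have hIeq : (mutualInfoBits ρ).toReal = ∫ y, Real.logb 2 (R y).toReal ∂ρ := by
    rw [mutualInfoBits, ENNReal.toReal_div, ENNReal.toReal_ofReal hl2.le,
      InformationTheory.toReal_klDiv_of_measure_eq hac (by simp), integral_congr_ae hllr,
      ← integral_div]
    rfl
  set h : 𝓧 × 𝓩 → ℝ := fun y => max 0 (Real.logb 2 J - Real.logb 2 (R y).toReal) with hhdef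
  have hlb : Measurable fun y => Real.logb 2 (R y).toReal :=
    (Real.measurable_log.comp hR.ennreal_toReal).div_const _
  have hh : Measurable h := measurable_const.max (measurable_const.sub hlb)
  have h0 : ∀ y, 0 ≤ h y := fun y => le_max_left _ _
  have hEh : ∫⁻ x, epsilonCost J (Q x) p (q x) ∂ρ.fst = ∫⁻ y, ENNReal.ofReal (h y) ∂ρ :=
    lintegral_eq_of_compProd hQ hh.ennreal_ofReal
  have hhint : Integrable h ρ := by
    refine ⟨hh.aestronglyMeasurable, ?_⟩
    rw [hasFiniteIntegral_iff_ofReal (Eventually.of_forall h0), ← hEh]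
    exact hE.lt_top
  have hEeq : (∫⁻ x, epsilonCost J (Q x) p (q x) ∂ρ.fst).toReal = ∫ y, h y ∂ρ := by
    rw [hEh, integral_eq_lintegral_of_nonneg_ae (Eventually.of_forall h0)
      hh.aestronglyMeasurable]
  have hA : (mutualInfoBits ρ).toReal - Real.logb 2 J +
      (∫⁻ x, epsilonCost J (Q x) p (q x) ∂ρ.fst).toReal + 1 =
      ∫ y, (Real.logb 2 (R y).toReal - Real.logb 2 J + h y + 1) ∂ρ := by
    have h1 : Integrable (fun y => Real.logb 2 (R y).toReal - Real.logb 2 J) ρ :=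
      hlogint.sub (integrable_const _)
    have h2 : Integrable (fun y => Real.logb 2 (R y).toReal - Real.logb 2 J + h y) ρ :=
      h1.add hhint
    rw [integral_add h2 (integrable_const _), integral_add h1 hhint,
      integral_sub hlogint (integrable_const _), hIeq, hEeq]
    simp
  have hAint : Integrable (fun y => Real.logb 2 (R y).toReal - Real.logb 2 J + h y + 1) ρ :=
    ((hlogint.sub (integrable_const _)).add hhint).add (integrable_const _)
  have hA1 : ∀ y, 1 ≤ Real.logb 2 (R y).toReal - Real.logb 2 J + h y + 1 := fun y => by
    have : Real.logb 2 J - Real.logb 2 (R y).toReal ≤ h y := le_max_right _ _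
    linarith
  rw [hA]
  refine ⟨?_, ?_⟩
  · calc (1 : ℝ) = ∫ _, 1 ∂ρ := by simp
      _ ≤ _ := integral_mono (integrable_const _) hAint hA1
  · have hm : Measurable fun y : 𝓧 × 𝓩 => ENNReal.ofReal (Real.log (1 + (R y).toReal / J)) := by
      fun_prop
    refine (lintegral_eq_of_compProd hQ hm).le.trans ?_
    rw [← integral_mul_const, ofReal_integral_eq_lintegral_ofReal (hAint.mul_const _)
      (Eventually.of_forall fun y => mul_nonneg (by linarith [hA1 y]) hl2.le)]
    refine lintegral_mono_ae ?_
    filter_upwards [hRtop, hR0] with y h1 h2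
    exact ENNReal.ofReal_le_ofReal (log_one_add_le hJ (ENNReal.toReal_pos h2 h1))

end Information

/-! ### The entropy of the code -/

section Final
open scoped Classical NNReal
variable {𝓧 𝓩 : Type*} {J : ℕ}

/-- The code of the point of least score. The output of the encoder is almost surely equal to it,
but depends on a supremum over all of `𝓩`, which need not be measurable in the data. -/
def selectedCode (g : Fin J × 𝓩 → ℝ≥0) (ω : Randomness 𝓩 J) : Option (Fin J × ℕ) :=
  if h : ∃ n, IsArgmin g (markedPoints ω) n then some (sampleIndex ω.2.1 h.choose) else none

lemma selectedCode_eq {g : Fin J × 𝓩 → ℝ≥0} {ω : Randomness 𝓩 J} {n : ℕ}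
    (hn : IsArgmin g (markedPoints ω) n) : selectedCode g ω = some (sampleIndex ω.2.1 n) := by
  have h : ∃ n, IsArgmin g (markedPoints ω) n := ⟨n, hn⟩
  rw [selectedCode, dif_pos h, h.choose_spec.unique hn]

lemma logIndex_selectedCode (g : Fin J × 𝓩 → ℝ≥0) (ω : Randomness 𝓩 J) :
    logIndex (selectedCode g ω) = ∑' n, if IsArgmin g (markedPoints ω) n then
      ENNReal.ofReal (Real.log ((earlierInBin Prod.fst (markedPoints ω) n : ℝ) + 1)) else 0 := by
  by_cases h : ∃ n, IsArgmin g (markedPoints ω) n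
  · obtain ⟨n, hn⟩ := h
    rw [tsum_isArgmin_eq hn, selectedCode_eq hn, sampleIndex, logIndex, Nat.cast_add, Nat.cast_one]
    rfl
  · rw [selectedCode, dif_neg h, logIndex]
    push Not at h
    simp [h]

variable [MeasurableSpace 𝓧] [MeasurableSpace 𝓩] {ν : Measure 𝓩} {p : 𝓩 → ℝ≥0∞}
  {q : 𝓧 → 𝓩 → ℝ≥0∞} {B : BinSystem ν p J}
  {π : Kernel 𝓧 (Fin J)}

lemma measurable_weight {β : Type*} [MeasurableSpace β] {x : β → 𝓧} {j : β → Fin J}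
    (hx : Measurable x) (hj : Measurable j) : Measurable fun a => π (x a) {j a} :=
  (measurable_from_prod_countable_left fun j => π.measurable_coe (measurableSet_singleton j) :
    Measurable fun y : 𝓧 × Fin J => π y.1 {y.2}).comp (hx.prodMk hj)

lemma measurable_mark (n : ℕ) :
    Measurable fun ω : 𝓧 × Randomness 𝓩 J => (markedPoints ω.2 n).1 :=
  measurable_fst.comp ((measurable_pi_apply n).comp (measurable_markedPoints.comp measurable_snd))

lemma measurable_pointScore_markedPoints (hp : Measurable p)
    (hq : Measurable (Function.uncurry q)) (n : ℕ) :
    Measurable fun ω : 𝓧 × Randomness 𝓩 J =>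
      pointScore (gain p (q ω.1) fun j => π ω.1 {j}) (markedPoints ω.2) n := by
  have hm : Measurable fun ω : 𝓧 × Randomness 𝓩 J => arrival (markedPoints ω.2) (n + 1) :=
    (measurable_arrival (n + 1)).comp (measurable_markedPoints.comp measurable_snd)
  have hz : Measurable fun ω : 𝓧 × Randomness 𝓩 J => (markedPoints ω.2 n).1.2 :=
    measurable_snd.comp (measurable_mark n)
  have hqz : Measurable fun ω : 𝓧 × Randomness 𝓩 J => q ω.1 (markedPoints ω.2 n).1.2 :=
    hq.comp (measurable_fst.prodMk hz)
  have hπ : Measurable fun ω : 𝓧 × Randomness 𝓩 J => π ω.1 {(markedPoints ω.2 n).1.1} :=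
    measurable_weight measurable_fst (measurable_fst.comp (measurable_mark n))
  exact hm.ennreal_ofReal.div ((hqz.div (hp.comp hz)).mul
    (hπ.const_div _)).ennreal_toNNReal.coe_nnreal_ennreal

lemma measurableSet_isArgmin_markedPoints (hp : Measurable p)
    (hq : Measurable (Function.uncurry q)) (n : ℕ) :
    MeasurableSet {ω : 𝓧 × Randomness 𝓩 J |
      IsArgmin (gain p (q ω.1) fun j => π ω.1 {j}) (markedPoints ω.2) n} := by
  unfold IsArgmin
  simp_rw [Set.ofPred_forall]
  exact MeasurableSet.iInter fun i => MeasurableSet.iInter fun _ => measurableSet_lt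
    (measurable_pointScore_markedPoints hp hq n) (measurable_pointScore_markedPoints hp hq i)

lemma measurableSet_selectedCode (hp : Measurable p) (hq : Measurable (Function.uncurry q))
    (c : Option (Fin J × ℕ)) : MeasurableSet {ω : 𝓧 × Randomness 𝓩 J |
      selectedCode (gain p (q ω.1) fun j => π ω.1 {j}) ω.2 = c} := by
  have hA := fun n => measurableSet_isArgmin_markedPoints (π := π) hp hq n
  cases c with
  | none =>
    have h : {ω : 𝓧 × Randomness 𝓩 J |
        selectedCode (gain p (q ω.1) fun j => π ω.1 {j}) ω.2 = none} =
        (⋃ n, {ω : 𝓧 × Randomness 𝓩 J |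
          IsArgmin (gain p (q ω.1) fun j => π ω.1 {j}) (markedPoints ω.2) n})ᶜ := by
      ext ω
      simp [selectedCode]
    rw [h]
    exact (MeasurableSet.iUnion hA).compl
  | some c =>
    have h : {ω : 𝓧 × Randomness 𝓩 J |
        selectedCode (gain p (q ω.1) fun j => π ω.1 {j}) ω.2 = some c} =
        ⋃ n, ({ω : 𝓧 × Randomness 𝓩 J |
          IsArgmin (gain p (q ω.1) fun j => π ω.1 {j}) (markedPoints ω.2) n} ∩
          {ω | sampleIndex ω.2.2.1 n = c}) := by
      ext ω
      simp only [Set.mem_iUnion, Set.mem_inter_iff, Set.mem_ofPred_eq]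
      constructor
      · intro hω
        by_cases hex : ∃ n, IsArgmin (gain p (q ω.1) fun j => π ω.1 {j}) (markedPoints ω.2) n
        · obtain ⟨n, hn⟩ := hex
          rw [selectedCode_eq hn] at hω
          exact ⟨n, hn, Option.some.inj hω⟩
        · rw [selectedCode, dif_neg hex] at hω
          cases hω
      · rintro ⟨n, hn, rfl⟩
        exact selectedCode_eq hn
    rw [h]
    refine MeasurableSet.iUnion fun n => (hA n).inter ?_
    exact ((measurable_sampleIndex n).comp
      (measurable_fst.comp (measurable_snd.comp measurable_snd))) (measurableSet_singleton c)

lemma randomnessKernel_apply [IsMarkovKernel π] (x : 𝓧) :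
    randomnessKernel B π x = (Measure.infinitePi fun _ : ℕ => expMeasure 1).prod
      ((Measure.infinitePi fun _ : ℕ => π x).prod
        (Measure.infinitePi fun jk : Fin J × ℕ => B.law jk.1)) := by
  rw [randomnessKernel, Kernel.prod_apply, Kernel.prod_apply, Kernel.const_apply,
    Kernel.const_apply]
  rfl

lemma map_randomnessKernel [IsMarkovKernel π] (x : 𝓧) :
    (randomnessKernel B π x).map markedPoints = poissonLaw (markLaw B (π x)) := by
  rw [randomnessKernel_apply, map_markedPoints]

lemma elog2_coe {A : ℝ} (hA : 0 < A) : elog2 (A : EReal) = (Real.logb 2 A : ℝ) := by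
  rw [elog2, EReal.toENNReal_of_ne_top (EReal.coe_ne_top A), EReal.toReal_coe,
    ENNReal.log_ofReal_of_pos hA, ← EReal.coe_div, Real.logb]

lemma elog2_top : elog2 ⊤ = ⊤ := by
  rw [elog2, EReal.toENNReal_top, ENNReal.log_top,
    EReal.top_div_of_pos_ne_top (by exact_mod_cast Real.log_pos one_lt_two) (EReal.coe_ne_top _)]

/-- The right-hand side of the bound is infinite unless both information terms are finite. -/
lemma bound_eq_top {I E : ℝ≥0∞} (h : I = ∞ ∨ E = ∞) (c : ℝ) :
    (I : EReal) + (E : EReal) + elog2 ((I : EReal) - (c : ℝ) + (E : EReal) + 1) + 4 = ⊤ := by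
  have h1 : (I : EReal) + (E : EReal) = ⊤ := by
    rw [← EReal.coe_ennreal_add, EReal.coe_ennreal_eq_top_iff]
    simpa using h
  have h2 : (I : EReal) - (c : ℝ) + (E : EReal) = ⊤ := by
    rw [sub_eq_add_neg, add_right_comm, h1]
    exact EReal.top_sub_coe c
  have h3 : (⊤ : EReal) + 1 = ⊤ := EReal.top_add_of_ne_bot (EReal.coe_ne_bot 1)
  have h4 : (⊤ : EReal) + 4 = ⊤ := EReal.top_add_of_ne_bot (EReal.coe_ne_bot 4)
  rw [h2, h3, elog2_top, h1, EReal.top_add_top, h4]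

/-- Almost surely, the code is the index of the unique point of least score. -/
lemma ae_output_eq_selectedCode {ρ : Measure (𝓧 × 𝓩)} [IsProbabilityMeasure ρ] {Q : Kernel 𝓧 𝓩}
    [IsMarkovKernel Q] (hQ : ρ.fst ⊗ₘ Q = ρ) (hp : Measurable p) (hpP : ρ.snd = ν.withDensity p)
    (hq : Measurable (Function.uncurry q)) (hqQ : ∀ᵐ x ∂ρ.fst, Q x = ν.withDensity (q x))
    [IsMarkovKernel π] (hπ : ∀ᵐ x ∂ρ.fst, ∀ j, Q x (B.region j) ≠ 0 → π x {j} ≠ 0) :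
    ∀ᵐ ω ∂(ρ.fst ⊗ₘ randomnessKernel B π),
      output (run B (q ω.1) (fun j => π ω.1 {j}) ω.2) =
        selectedCode (gain p (q ω.1) fun j => π ω.1 {j}) ω.2 ∧
      ∃ j k, selectedCode (gain p (q ω.1) fun j => π ω.1 {j}) ω.2 = some (j, k + 1) := by
  have hptop := ae_ne_top_of_withDensity (ν := ν) hp (hpP ▸ inferInstance)
  have hset : MeasurableSet {ω : 𝓧 × Randomness 𝓩 J | (∀ n, 0 < (markedPoints ω.2 n).2) ∧
      (∀ n, RegularMark B (q ω.1) (fun j => π ω.1 {j}) (markedPoints ω.2 n).1) ∧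
      ∃ n, IsArgmin (gain p (q ω.1) fun j => π ω.1 {j}) (markedPoints ω.2) n ∧
        pointScore (gain p (q ω.1) fun j => π ω.1 {j}) (markedPoints ω.2) n ≠ ∞} := by
    have h1 : MeasurableSet {ω : 𝓧 × Randomness 𝓩 J | ∀ n, 0 < (markedPoints ω.2 n).2} := by
      rw [Set.ofPred_forall]
      exact MeasurableSet.iInter fun n => measurableSet_lt measurable_const (by fun_prop)
    have h2 : MeasurableSet {ω : 𝓧 × Randomness 𝓩 J | ∀ n,
        RegularMark B (q ω.1) (fun j => π ω.1 {j}) (markedPoints ω.2 n).1} := by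
      rw [Set.ofPred_forall]
      refine MeasurableSet.iInter fun n => measurableSet_regularMark hp
        (measurable_weight measurable_fst (measurable_fst.comp (measurable_mark n))) ?_
        (measurable_mark n)
      exact hq.comp (measurable_fst.prodMk (measurable_snd.comp (measurable_mark n)))
    have h3 : MeasurableSet {ω : 𝓧 × Randomness 𝓩 J | ∃ n,
        IsArgmin (gain p (q ω.1) fun j => π ω.1 {j}) (markedPoints ω.2) n ∧
        pointScore (gain p (q ω.1) fun j => π ω.1 {j}) (markedPoints ω.2) n ≠ ∞} := by
      rw [Set.ofPred_exists]
      exact MeasurableSet.iUnion fun n => (measurableSet_isArgmin_markedPoints hp hq n).inter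
        (measurable_pointScore_markedPoints hp hq n (measurableSet_singleton ∞)).compl
    exact h1.inter (h2.inter h3)
  have hgood : ∀ᵐ ω ∂(ρ.fst ⊗ₘ randomnessKernel B π), (∀ n, 0 < (markedPoints ω.2 n).2) ∧
      (∀ n, RegularMark B (q ω.1) (fun j => π ω.1 {j}) (markedPoints ω.2 n).1) ∧
      ∃ n, IsArgmin (gain p (q ω.1) fun j => π ω.1 {j}) (markedPoints ω.2) n ∧
        pointScore (gain p (q ω.1) fun j => π ω.1 {j}) (markedPoints ω.2) n ≠ ∞ := by
    rw [Measure.ae_compProd_iff hset]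
    filter_upwards [hqQ, hπ, ae_ae_density_eq_zero hQ hp hpP hq hqQ] with x hqx hπx hac
    have hqm : Measurable (q x) := hq.comp measurable_prodMk_left
    have hprob : IsProbabilityMeasure (ν.withDensity (q x)) := hqx ▸ inferInstance
    rw [hqx] at hπx
    have h := ae_regular_and_exists_isArgmin (B := B) (α := π x) hp hqm hptop
      (ae_ne_top_of_withDensity hqm inferInstance) hac hπx
    rw [← map_randomnessKernel] at h
    exact ae_of_ae_map (by fun_prop) h
  filter_upwards [hgood] with ω hω
  obtain ⟨h1, h2, n, hn, hfin⟩ := hω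
  rw [selectedCode_eq hn]
  exact ⟨output_run_eq ω.2 h1 h2 hn hfin, _, _, rfl⟩

/-- The mean logarithm of the second part of the code. -/
lemma lintegral_logIndex_le {ρ : Measure (𝓧 × 𝓩)} [IsProbabilityMeasure ρ] {Q : Kernel 𝓧 𝓩}
    [IsMarkovKernel Q] (hQ : ρ.fst ⊗ₘ Q = ρ) (hp : Measurable p) (hpP : ρ.snd = ν.withDensity p)
    (hq : Measurable (Function.uncurry q)) (hqQ : ∀ᵐ x ∂ρ.fst, Q x = ν.withDensity (q x))
    [IsMarkovKernel π] (hπ : ∀ᵐ x ∂ρ.fst, ∀ j, Q x (B.region j) ≠ 0 → π x {j} ≠ 0) :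
    ∫⁻ ω, logIndex (selectedCode (gain p (q ω.1) fun j => π ω.1 {j}) ω.2)
        ∂(ρ.fst ⊗ₘ randomnessKernel B π) ≤
      ∫⁻ x, ∫⁻ z, ENNReal.ofReal (Real.log (1 + (q x z / p z).toReal / J)) ∂(Q x) ∂ρ.fst := by
  have hptop := ae_ne_top_of_withDensity (ν := ν) hp (hpP ▸ inferInstance)
  rw [Measure.lintegral_compProd
    (measurable_comp_of_countable (measurableSet_selectedCode hp hq) logIndex)]
  refine lintegral_mono_ae ?_
  filter_upwards [hqQ, hπ, ae_ae_density_eq_zero hQ hp hpP hq hqQ] with x hqx hπx hac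
  have hqm : Measurable (q x) := hq.comp measurable_prodMk_left
  have hprob : IsProbabilityMeasure (ν.withDensity (q x)) := hqx ▸ inferInstance
  rw [hqx] at hπx ⊢
  refine le_trans (le_of_eq ?_) (tsum_lintegral_log_binCount_le (B := B) (α := π x) hp hqm hptop
    (ae_ne_top_of_withDensity hqm inferInstance) hac hπx)
  have hm : ∀ n, Measurable fun w : ℕ → (Fin J × 𝓩) × ℝ =>
      if IsArgmin (gain p (q x) fun j => π x {j}) w n then
        ENNReal.ofReal (Real.log ((earlierInBin Prod.fst w n : ℝ) + 1)) else 0 := fun n =>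
    Measurable.ite (measurableSet_isArgmin (measurable_gain hp hqm _) n)
      ((measurable_of_countable fun k : ℕ => ENNReal.ofReal (Real.log ((k : ℝ) + 1))).comp
        (measurable_earlierInBin measurable_fst n)) measurable_const
  simp_rw [logIndex_selectedCode]
  rw [← map_randomnessKernel (B := B) x]
  simp_rw [lintegral_map (hm _) measurable_markedPoints]
  exact lintegral_tsum fun n => ((hm n).comp measurable_markedPoints).aemeasurable

end Final

end SpacePartitionPFR

end

open SpacePartitionPFR in
theorem theorem3p1 {𝓧 𝓩 : Type*} [MeasurableSpace 𝓧] [MeasurableSpace 𝓩]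
    (ρ : Measure (𝓧 × 𝓩)) [IsProbabilityMeasure ρ]
    (Q : Kernel 𝓧 𝓩) [IsMarkovKernel Q] (hQ : ρ.fst ⊗ₘ Q = ρ)
    (ν : Measure 𝓩) [SigmaFinite ν]
    (p : 𝓩 → ℝ≥0∞) (hp : Measurable p) (hpP : ρ.snd = ν.withDensity p)
    (q : 𝓧 → 𝓩 → ℝ≥0∞) (hq : Measurable (Function.uncurry q))
    (hqQ : ∀ᵐ x ∂ρ.fst, Q x = ν.withDensity (q x))
    (J : ℕ) (B : BinSystem ν p J)
    (π : Kernel 𝓧 (Fin J)) [IsMarkovKernel π]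
    (hπ : ∀ᵐ x ∂ρ.fst, ∀ j, Q x (B.region j) ≠ 0 → π x {j} ≠ 0) :
    let μ : Measure (𝓧 × Randomness 𝓩 J) := ρ.fst ⊗ₘ randomnessKernel B π
    let C : 𝓧 × Randomness 𝓩 J → Option (Fin J × ℕ) :=
      fun ω => output (run B (q ω.1) (fun j => π ω.1 {j}) ω.2)
    let I : ℝ≥0∞ := mutualInfoBits ρ
    let E : ℝ≥0∞ := ∫⁻ x, epsilonCost J (Q x) p (q x) ∂ρ.fst
    (∀ᵐ ω ∂μ, C ω ≠ none) ∧
      (entropyBits μ C : EReal) ≤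
        (I : EReal) + (E : EReal)
          + elog2 ((I : EReal) - (Real.logb 2 J : ℝ) + (E : EReal) + 1) + 4 := by
  intro μ C I E
  have hae := ae_output_eq_selectedCode hQ hp hpP hq hqQ hπ
  refine ⟨?_, ?_⟩
  · filter_upwards [hae] with ω hω
    obtain ⟨h, j, k, hjk⟩ := hω
    have : C ω = some (j, k + 1) := h.trans hjk
    rw [this]
    exact Option.some_ne_none _
  by_cases htop : I = ∞ ∨ E = ∞
  · rw [bound_eq_top htop]
    exact le_top
  push Not at htop
  have hJ : 0 < J := by
    obtain ⟨ω, -, j, -⟩ := hae.exists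
    exact j.pos
  set C' : 𝓧 × Randomness 𝓩 J → Option (Fin J × ℕ) :=
    fun ω => selectedCode (gain p (q ω.1) fun j => π ω.1 {j}) ω.2 with hC'
  obtain ⟨hA1, hlog⟩ := lintegral_log_ratio_le hQ hp hpP hq hqQ hJ htop.1 htop.2
  set A : ℝ := I.toReal - Real.logb 2 J + E.toReal + 1 with hA
  have hAdef : (I : EReal) - (Real.logb 2 J : ℝ) + (E : EReal) + 1 = (A : ℝ) := by
    rw [← EReal.coe_ennreal_toReal htop.1, ← EReal.coe_ennreal_toReal htop.2, hA]
    norm_cast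
  have hAm : (0 : ℝ) < A := by linarith
  have hent : entropyBits μ C = entropyBits μ C' := by
    refine tsum_congr fun c => ?_
    have : μ {ω | C ω = c} = μ {ω | C' ω = c} := by
      refine measure_congr ?_
      filter_upwards [hae] with ω hω
      have h : C ω = C' ω := hω.1
      exact congrArg (fun d => d = c) h
    rw [measureReal_def, measureReal_def, this]
  have hbound := entropyBits_le μ (measurableSet_selectedCode hp hq)
    (hae.mono fun ω hω => hω.2) hAm ((lintegral_logIndex_le hQ hp hpP hq hqQ hπ).trans hlog)
  have hlogA : Real.logb 2 (1 + A) ≤ 1 + Real.logb 2 A := by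
    have h := Real.logb_le_logb_of_le one_lt_two (by linarith : (0 : ℝ) < 1 + A)
      (by linarith : 1 + A ≤ 2 * A)
    rwa [Real.logb_mul two_ne_zero hAm.ne', Real.logb_self_eq_one one_lt_two] at h
  have hX : Real.logb 2 J + A + Real.logb 2 (1 + A) + 1 ≤
      I.toReal + E.toReal + Real.logb 2 A + 4 := by
    rw [hA] at hlogA ⊢
    linarith
  have hX0 : 0 ≤ I.toReal + E.toReal + Real.logb 2 A + 4 := by
    have := Real.logb_nonneg one_lt_two hA1
    positivity
  rw [hAdef, elog2_coe hAm, hent, ← EReal.coe_ennreal_toReal htop.1,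
    ← EReal.coe_ennreal_toReal htop.2]
  have h1 : ((I.toReal : EReal) + (E.toReal : EReal) + (Real.logb 2 A : ℝ) + 4) =
      ((I.toReal + E.toReal + Real.logb 2 A + 4 : ℝ) : EReal) := by norm_cast
  rw [h1, ← max_eq_left hX0, ← EReal.coe_ennreal_ofReal, EReal.coe_ennreal_le_coe_ennreal_iff]
  exact hbound.trans (ENNReal.ofReal_le_ofReal hX)
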